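/- Let $G$ be a finite group and let $R$ be a commutative ring with unit. Conventions. An $R$-algebra $A$ is a *symmetric algebra* if it is a finitely generated projective $R$-module and there is an $R$-bilinear form $b$ on $A$ with $b(xy,z)=b(x,yz)$ and $b(x,y)=b(y,x)$ for all $x,y,z\in A$ which is non-degenerate, i.e. such that $x\mapsto b(x,-)$ is an isomorphism $A\to \mathrm{Hom}_R(A,R)$ of $R$-modules. Write ${}^gH=gHg^{-1}$ and $H^g=g^{-1}Hg$. The *Mackey algebra* $\mu_R(G)$ is the unital associative $R$-algebra with generators $t^K_H$, $r^K_H$, $c_{g,H}$ for $H\leqslant K\leqslant G$, $g\in G$, and relations - $\sum_{H\leqslant G}t^H_H=1$; - $t^H_H=r^H_H=c_{h,H}$ for $h\in H$; - $t^L_Kt^K_H=t^L_H$ and $r^K_Hr^L_K=r^L_H$ for $H\leqslant K\leqslant L$; - $c_{g',{}^gH}\,c_{g,H}=c_{g'g,H}$; - $t^{{}^gK}_{{}^gH}c_{g,H}=c_{g,K}t^K_H$ and $r^{{}^gK}_{{}^gH}c_{g,K}=c_{g,H}r^K_H$ for $H\leqslant K$; - $r^H_Lt^H_K=\sum_{h\in[L\backslash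 H/K]}t^L_{L\cap{}^hK}\,c_{h,L^h\cap K}\,r^K_{L^h\cap K}$ for $L,K\leqslant H$; - $ab=0$ for generators $a,b$ that are not composable, i.e. such that the source of $a$ differs from the target of $b$, where $t^K_H$ goes from $H$ to $K$, $r^K_H$ from $K$ to $H$, and $c_{g,H}$ from $H$ to ${}^gH$. For $H\leqslant G$, $RB(H)$ denotes the Burnside algebra of $H$: the $R$-module generated by the isomorphism classes of finite $H$-sets subject to $[X\sqcup Y]=[X]+[Y]$, with the product induced by the cartesian product. The family $(RB(H))_{H\leqslant G}$ is a *stable by induction family of symmetric algebras* if there are $R$-linear forms $\phi_H:RB(H)\to R$, for $H\leqslant G$, such that $\phi_G(\mathrm{Ind}_H^G X)=\phi_H(X)$ for every $H\leqslant G$ and every finite $H$-set $X$, and such that for every $H\leqslant G$ the bilinear form $(X,Y)\mapsto\phi_H(XY)$ on $RB(H)$ is non-degenerate, i.e. induces an isomorphism $RB(H)\to\mathrm{Hom}_R(RB(H),R)$. **Theorem.** The Mackey algebra $\mu_R(G)$ is a symmetric algebra if and only if $(RB(H))_{H\leqslant G}$ is a stable by induction family of symmetric algebras. -/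

import Mathlib

open scoped Pointwise

universe u v

/-! ## Symmetric algebras -/

/-- An `R`-algebra `A` is a symmetric algebra if it is a finitely generated projective `R`-module
and carries a bilinear form `b` which is associative, symmetric, and non-degenerate in the sense
that `x ↦ b(x, -)` is an isomorphism from `A` onto `Hom_R(A, R)`. -/
def IsSymmAlgebra (R : Type*) (A : Type*) [CommRing R] [Ring A] [Algebra R A] : Prop :=
  Module.Finite R A ∧ Module.Projective R A ∧
    ∃ b : A →ₗ[R] Module.Dual R A,
      (∀ x y z : A, b (x * y) z = b x (y * z)) ∧
      (∀ x y : A, b x y = b y x) ∧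
      Function.Bijective b

/-! ## The Mackey algebra -/

/-- The conjugate subgroup `ᵍH = g H g⁻¹`. -/
abbrev conjSubgroup {G : Type u} [Group G] (g : G) (H : Subgroup G) : Subgroup G :=
  MulAut.conj g • H

/-- The generators of the Mackey algebra: `t K H` is `t^K_H` and `r K H` is `r^K_H`, for
`H ≤ K ≤ G`, and `c g H` is `c_{g,H}`, for `g ∈ G` and `H ≤ G`. -/
inductive MackeyGen (G : Type u) [Group G] : Type u
  | t (K H : Subgroup G) (h : H ≤ K) : MackeyGen G
  | r (K H : Subgroup G) (h : H ≤ K) : MackeyGen G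
  | c (g : G) (H : Subgroup G) : MackeyGen G

namespace MackeyGen

variable {G : Type u} [Group G]

/-- The subgroup at which a generator starts: `t^K_H : H → K`, `r^K_H : K → H`,
`c_{g,H} : H → ᵍH`. -/
def source : MackeyGen G → Subgroup G
  | t _ H _ => H
  | r K _ _ => K
  | c _ H => H

/-- The subgroup at which a generator ends: `t^K_H : H → K`, `r^K_H : K → H`,
`c_{g,H} : H → ᵍH`. -/
def target : MackeyGen G → Subgroup G
  | t K _ _ => K
  | r _ H _ => H
  | c g H => conjSubgroup g H

end MackeyGen

section MackeyAlgebra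

variable (R : Type v) [CommRing R] {G : Type u} [Group G]

/-- `t^K_H` in the free algebra on the generators. -/
def freeT (K H : Subgroup G) (h : H ≤ K) : FreeAlgebra R (MackeyGen G) :=
  FreeAlgebra.ι R (MackeyGen.t K H h)

/-- `r^K_H` in the free algebra on the generators. -/
def freeR (K H : Subgroup G) (h : H ≤ K) : FreeAlgebra R (MackeyGen G) :=
  FreeAlgebra.ι R (MackeyGen.r K H h)

/-- `c_{g,H}` in the free algebra on the generators. -/
def freeC (g : G) (H : Subgroup G) : FreeAlgebra R (MackeyGen G) :=
  FreeAlgebra.ι R (MackeyGen.c g H)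

/-- The defining relations of the Mackey algebra. In the Mackey formula `mackey`, `x` runs over
the double cosets `L \ H / K`, and `h = x.out ∈ H` is a representative of `x`. The last relation
says that products of two generators that are not composable are zero. -/
inductive MackeyRel : FreeAlgebra R (MackeyGen G) → FreeAlgebra R (MackeyGen G) → Prop
  | one : MackeyRel (∑ᶠ H : Subgroup G, freeT R H H le_rfl) 1
  | t_self_eq_r_self (H : Subgroup G) : MackeyRel (freeT R H H le_rfl) (freeR R H H le_rfl)
  | t_self_eq_c (H : Subgroup G) (h : G) (hh : h ∈ H) :
      MackeyRel (freeT R H H le_rfl) (freeC R h H)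
  | t_trans (L K H : Subgroup G) (hKL : K ≤ L) (hHK : H ≤ K) :
      MackeyRel (freeT R L K hKL * freeT R K H hHK) (freeT R L H (hHK.trans hKL))
  | r_trans (L K H : Subgroup G) (hKL : K ≤ L) (hHK : H ≤ K) :
      MackeyRel (freeR R K H hHK * freeR R L K hKL) (freeR R L H (hHK.trans hKL))
  | c_mul (g' g : G) (H : Subgroup G) :
      MackeyRel (freeC R g' (conjSubgroup g H) * freeC R g H) (freeC R (g' * g) H)
  | t_conj (g : G) (K H : Subgroup G) (hHK : H ≤ K) :
      MackeyRel
        (freeT R (conjSubgroup g K) (conjSubgroup g H)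
            (Subgroup.pointwise_smul_le_pointwise_smul_iff.2 hHK) * freeC R g H)
        (freeC R g K * freeT R K H hHK)
  | r_conj (g : G) (K H : Subgroup G) (hHK : H ≤ K) :
      MackeyRel
        (freeR R (conjSubgroup g K) (conjSubgroup g H)
            (Subgroup.pointwise_smul_le_pointwise_smul_iff.2 hHK) * freeC R g K)
        (freeC R g H * freeR R K H hHK)
  | mackey (H L K : Subgroup G) (hLH : L ≤ H) (hKH : K ≤ H) :
      MackeyRel
        (freeR R H L hLH * freeT R H K hKH)
        (∑ᶠ x : DoubleCoset.Quotient (L.subgroupOf H : Set H) (K.subgroupOf H : Set H),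
          freeT R L (L ⊓ conjSubgroup (x.out : G) K) inf_le_left *
            freeC R (x.out : G) (conjSubgroup (x.out : G)⁻¹ L ⊓ K) *
            freeR R K (conjSubgroup (x.out : G)⁻¹ L ⊓ K) inf_le_right)
  | zero (a b : MackeyGen G) (hab : a.source ≠ b.target) :
      MackeyRel (FreeAlgebra.ι R a * FreeAlgebra.ι R b) 0

variable (G)

/-- The Mackey algebra `μ_R(G)`: the unital associative `R`-algebra presented by the generators
`MackeyGen` and the relations `MackeyRel`. -/
abbrev MackeyAlgebra : Type (max u v) :=
  RingQuot (MackeyRel R (G := G))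

end MackeyAlgebra

/-! ## Burnside algebras -/

/-- Finite `H`-sets. -/
structure FinGSet (H : Type u) [Group H] : Type (u + 1) where
  carrier : Type u
  [action : MulAction H carrier]
  [finite : Finite carrier]

attribute [instance] FinGSet.action FinGSet.finite

namespace FinGSet

variable {H : Type u} [Group H]

/-- Isomorphism of `H`-sets: an equivariant bijection. -/
def Iso (X Y : FinGSet H) : Prop :=
  ∃ e : X.carrier ≃ Y.carrier, ∀ (h : H) (x : X.carrier), e (h • x) = h • e x

theorem iso_equivalence : Equivalence (Iso (H := H)) where
  refl _ := ⟨Equiv.refl _, fun _ _ => rfl⟩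
  symm := by
    rintro X Y ⟨e, he⟩
    refine ⟨e.symm, fun h y => ?_⟩
    rw [Equiv.symm_apply_eq, he, Equiv.apply_symm_apply]
  trans := by
    rintro X Y Z ⟨e, he⟩ ⟨f, hf⟩
    exact ⟨e.trans f, fun h x => by simp [he, hf]⟩

instance isoSetoid (H : Type u) [Group H] : Setoid (FinGSet H) :=
  ⟨Iso, iso_equivalence⟩

/-- Disjoint union of `H`-sets. -/
def sum (X Y : FinGSet H) : FinGSet H := ⟨X.carrier ⊕ Y.carrier⟩

/-- Cartesian product of `H`-sets, with the diagonal action. -/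
def prod (X Y : FinGSet H) : FinGSet H := ⟨X.carrier × Y.carrier⟩

/-- The `H`-set with one element. -/
def point (H : Type u) [Group H] : FinGSet H := ⟨PUnit.{u + 1}⟩

end FinGSet

/-- Isomorphism classes of finite `H`-sets. -/
def GSetClass (H : Type u) [Group H] : Type (u + 1) := Quotient (FinGSet.isoSetoid H)

namespace GSetClass

variable {H : Type u} [Group H]

/-- The isomorphism class of a finite `H`-set. -/
def mk (X : FinGSet H) : GSetClass H := Quotient.mk _ X

/-- Isomorphism classes of finite `H`-sets form a commutative monoid under cartesian product. -/
instance : CommMonoid (GSetClass H) where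
  mul := Quotient.map₂ FinGSet.prod (by
    rintro X X' ⟨e, he⟩ Y Y' ⟨f, hf⟩
    exact ⟨Equiv.prodCongr e f, fun h x => Prod.ext (he h x.1) (hf h x.2)⟩)
  one := mk (FinGSet.point H)
  mul_assoc := by
    rintro ⟨X⟩ ⟨Y⟩ ⟨Z⟩
    exact Quotient.sound ⟨Equiv.prodAssoc _ _ _, fun _ _ => rfl⟩
  one_mul := by
    rintro ⟨X⟩
    exact Quotient.sound ⟨Equiv.punitProd _, fun _ _ => rfl⟩
  mul_one := by
    rintro ⟨X⟩
    exact Quotient.sound ⟨Equiv.prodPUnit _, fun _ _ => rfl⟩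
  mul_comm := by
    rintro ⟨X⟩ ⟨Y⟩
    exact Quotient.sound ⟨Equiv.prodComm _ _, fun _ _ => rfl⟩

end GSetClass

section Burnside

variable (R : Type v) [CommRing R] (H : Type u) [Group H]

/-- The relations `[X ⊔ Y] = [X] + [Y]`. Since the product distributes over disjoint unions, the
ideal they span is also the `R`-submodule they span. -/
noncomputable def burnsideIdeal : Ideal (MonoidAlgebra R (GSetClass H)) :=
  Ideal.span {z | ∃ X Y : FinGSet H,
    z = MonoidAlgebra.of R _ (GSetClass.mk (X.sum Y)) -
      (MonoidAlgebra.of R _ (GSetClass.mk X) + MonoidAlgebra.of R _ (GSetClass.mk Y))}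

/-- The Burnside algebra `RB(H)`: the Grothendieck group, with coefficients in `R`, of finite
`H`-sets for the relations given by disjoint union, with the product induced by the cartesian
product of `H`-sets. It is the free `R`-module on the isomorphism classes of finite `H`-sets
modulo the relations `[X ⊔ Y] = [X] + [Y]`. -/
abbrev BurnsideAlgebra : Type (max (u + 1) v) :=
  MonoidAlgebra R (GSetClass H) ⧸ burnsideIdeal R H

variable {H}

/-- The element of `RB(H)` given by a finite `H`-set. -/
noncomputable def burnsideClass (X : FinGSet H) : BurnsideAlgebra R H :=
  Ideal.Quotient.mk (burnsideIdeal R H) (MonoidAlgebra.of R _ (GSetClass.mk X))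

end Burnside

/-! ## Induction -/

namespace FinGSet

variable {G : Type u} [Group G] {H K : Subgroup G}

/-- The equivalence relation `(k, x) ~ (k h⁻¹, h x)`, `h ∈ H`, on `K × X`. -/
def indSetoid (hHK : H ≤ K) (X : FinGSet H) : Setoid (K × X.carrier) where
  r p q := ∃ h : H, q = (p.1 * (Subgroup.inclusion hHK h)⁻¹, h • p.2)
  iseqv :=
    { refl := fun p => ⟨1, by simp⟩
      symm := by
        rintro p q ⟨h, rfl⟩
        exact ⟨h⁻¹, by simp⟩
      trans := by
        rintro p q r ⟨h, rfl⟩ ⟨h', rfl⟩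
        exact ⟨h' * h, by simp [mul_smul, mul_assoc]⟩ }

/-- Left translation on `K ×_H X`. -/
instance indAction (hHK : H ≤ K) (X : FinGSet H) : MulAction K (Quotient (indSetoid hHK X)) where
  smul k := Quotient.map (fun p => (k * p.1, p.2)) (by
    rintro p q ⟨h, rfl⟩
    exact ⟨h, by simp [mul_assoc]⟩)
  one_smul := by
    rintro ⟨p⟩
    exact congrArg (Quotient.mk (indSetoid hHK X)) (by simp)
  mul_smul := by
    rintro k k' ⟨p⟩
    exact congrArg (Quotient.mk (indSetoid hHK X)) (by simp [mul_assoc])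

/-- The induced `K`-set `Ind_H^K X = K ×_H X`. -/
def ind [Finite G] (hHK : H ≤ K) (X : FinGSet H) : FinGSet K :=
  ⟨Quotient (indSetoid hHK X)⟩

end FinGSet

/-! ## Stable by induction families -/

section Stable

variable (R : Type v) [CommRing R] {G : Type u} [Group G] [Finite G]

/-- A family of linear forms `φ_H : RB(H) → R`, for `H ≤ G`, is stable by induction if
`φ_G(Ind_H^G X) = φ_H(X)` for all `H ≤ G` and all finite `H`-sets `X`. The group `G` itself is
the subgroup `⊤`. -/
def IsStableByInduction (φ : ∀ H : Subgroup G, Module.Dual R (BurnsideAlgebra R H)) : Prop :=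
  ∀ (H : Subgroup G) (X : FinGSet H),
    φ ⊤ (burnsideClass R (X.ind (le_top : H ≤ ⊤))) = φ H (burnsideClass R X)

/-- The bilinear form `(X, Y) ↦ φ(X Y)` attached to a linear form `φ` on an algebra. -/
def mulForm {R : Type*} {A : Type*} [CommRing R] [Ring A] [Algebra R A] (φ : Module.Dual R A) :
    A →ₗ[R] Module.Dual R A :=
  (LinearMap.mul R A).compr₂ φ

variable (G)

/-- The family `(RB(H))_{H ≤ G}` is a stable by induction family of symmetric algebras: there is a
stable by induction family of linear forms `φ_H` on the `RB(H)` all of whose bilinear forms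
`(X, Y) ↦ φ_H(X Y)` are non-degenerate, that is, induce an isomorphism of `RB(H)` with its
`R`-linear dual. -/
def BurnsideStableSymmetric : Prop :=
  ∃ φ : ∀ H : Subgroup G, Module.Dual R (BurnsideAlgebra R H),
    IsStableByInduction R φ ∧ ∀ H : Subgroup G, Function.Bijective (mulForm (φ H))

end Stable

/-!
The Mackey algebra is the algebra of spans of finite `G`-sets on the `G`-set `Ω` of all left cosets
of all subgroups of `G`, with composition of spans as product (`MackeyAlgebra.spanEquiv`). Every
relation becomes a bijection of `G`-sets, the Mackey formula being the decomposition of the pullback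
`G/L ×_{G/H} G/K` into orbits (`span_mul_span_mackey`). Conversely the elements `t c r` span the
Mackey algebra, since they span a left ideal which contains `1`, and they go to the basis of
transitive spans; an inverse can therefore be written down on that basis.

As a module, the algebra of spans is the Burnside module `RB(Ω × Ω)` of finite `G`-sets over
`Ω × Ω`. For any finite `G`-set `Z`, taking fibres identifies `RB(Z)` with the product of the
`RB(G_z)`, with `z` running over the orbits of `Z` (`fibersHom_bijective`); the inverse is
induction.

Given a stable family `φ`, put `τ(X) = {x ∈ X | the two legs of X agree at x}` for a span `X`. The
form `(X, Y) ↦ φ_G(τ(X ∘ Y))` is associative and symmetric. Now `τ(X ∘ Y)` is the fibre product over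
`Ω × Ω` of `X` with the transpose of `Y`, and by stability `φ_G` of a `G`-set over `Z` is the sum of
the `φ_{G_z}` of its fibres. Hence the form is the orthogonal sum of the forms of the `RB(G_z)`
(`apply_traceHom_mul`), and it is non-degenerate.

Given a symmetrizing form `b`, put `λ = b(-, 1)` and `φ_H(X) = λ(Ind_H^G X)`, where `Ind_H^G X` is
regarded as a span from `G/G` to itself. Stability is transitivity of induction. The product of the
corners `RB(G/G × G/H) = RB(H)` and `RB(G/H × G/G) = RB(H)` of the algebra of spans is
`(X, Y) ↦ Ind_H^G(XY)` (`indHom_mul_indHom`), so the form of `φ_H` is the restriction of `b` to a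
pair of opposite corners, which is non-degenerate because `b` is symmetric.
-/

/-! ### Finite `G`-sets over a `G`-set -/

/-- The action on the subset cut out by an invariant predicate. -/
abbrev subtypeAction {G X : Type*} [Group G] [MulAction G X] (p : X → Prop)
    (hp : ∀ (g : G) x, p x → p (g • x)) : MulAction G {x // p x} where
  smul := fun g x => ⟨g • x.1, hp g x.1 x.2⟩
  one_smul := fun x => Subtype.ext (one_smul G x.1)
  mul_smul := fun g g' x => Subtype.ext (mul_smul g g' x.1)

/-- A finite `G`-set `X` with an equivariant map `X → Z`. -/
structure SetOver (G : Type u) [Group G] (Z : Type u) [MulAction G Z] : Type (u + 1) where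
  carrier : Type u
  [action : MulAction G carrier]
  [finite : Finite carrier]
  map : carrier → Z
  protected map_smul : ∀ (g : G) (x : carrier), map (g • x) = g • map x

attribute [instance] SetOver.action SetOver.finite

namespace SetOver

variable {G : Type u} [Group G] {Z : Type u} [MulAction G Z]

/-- Isomorphism over `Z`: an equivariant bijection which commutes with the maps to `Z`. -/
def Iso (X Y : SetOver G Z) : Prop :=
  ∃ e : X.carrier ≃ Y.carrier,
    (∀ (g : G) (x : X.carrier), e (g • x) = g • e x) ∧ ∀ x : X.carrier, Y.map (e x) = X.map x

theorem Iso.symm {X Y : SetOver G Z} : Iso X Y → Iso Y X := by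
  rintro ⟨e, he, hm⟩
  refine ⟨e.symm, fun g y => ?_, fun y => ?_⟩
  · rw [Equiv.symm_apply_eq, he, Equiv.apply_symm_apply]
  · rw [← hm, Equiv.apply_symm_apply]

/-- Disjoint union over `Z`. -/
def sum (X Y : SetOver G Z) : SetOver G Z where
  carrier := X.carrier ⊕ Y.carrier
  map := Sum.elim X.map Y.map
  map_smul := by rintro g (x | y) <;> simp [X.map_smul, Y.map_smul]

/-- The sub-`G`-set cut out by an invariant predicate. -/
def restrict (X : SetOver G Z) (p : X.carrier → Prop) (hp : ∀ (g : G) x, p x → p (g • x)) :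
    SetOver G Z where
  carrier := {x // p x}
  action := subtypeAction _ hp
  map := fun x => X.map x.1
  map_smul := fun g x => X.map_smul g x.1

theorem iso_restrict_sum (X : SetOver G Z) (p : X.carrier → Prop)
    (hp : ∀ (g : G) x, p x → p (g • x)) (hp' : ∀ (g : G) x, ¬ p x → ¬ p (g • x)) :
    Iso ((X.restrict p hp).sum (X.restrict (fun x => ¬ p x) hp')) X := by
  classical
  refine ⟨Equiv.sumCompl p, ?_, ?_⟩
  · rintro g (x | x) <;> rfl
  · rintro (x | x) <;> rfl

/-- The orbit `G / A → Z` with `A ↦ z`, where `A` fixes `z`. -/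
def orb [Finite G] (A : Subgroup G) (z : Z) (h : A ≤ MulAction.stabilizer G z) : SetOver G Z where
  carrier := G ⧸ A
  map := Quotient.lift (fun g : G => g • z) (by
    intro g g' hg
    have := h (QuotientGroup.leftRel_apply.1 hg)
    rw [MulAction.mem_stabilizer_iff, mul_smul, inv_smul_eq_iff] at this
    exact this.symm)
  map_smul := by
    rintro g ⟨g'⟩
    exact mul_smul g g' z

section orb

variable [Finite G] {A : Subgroup G} {z : Z} {h : A ≤ MulAction.stabilizer G z}

/-- The base point of the orbit `G / A → Z`. -/
def orbPt : (orb A z h).carrier := ((1 : G) : G ⧸ A)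

theorem stabilizer_orbPt : MulAction.stabilizer G (orbPt : (orb A z h).carrier) = A :=
  MulAction.stabilizer_quotient A

theorem map_orbPt : (orb A z h).map orbPt = z :=
  one_smul G z

theorem exists_smul_orbPt (y : (orb A z h).carrier) : ∃ g : G, g • orbPt = y := by
  obtain ⟨g⟩ := y
  exact ⟨g, congrArg (Quotient.mk _) (mul_one g)⟩

theorem smul_orbPt_eq_iff {g g' : G} :
    g • (orbPt : (orb A z h).carrier) = g' • orbPt ↔ g⁻¹ * g' ∈ A := by
  rw [eq_comm, ← inv_smul_eq_iff, smul_smul, ← MulAction.mem_stabilizer_iff, stabilizer_orbPt]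

end orb

theorem iso_of_transitive [Finite G] (X : SetOver G Z) (x : X.carrier)
    (hx : ∀ y, ∃ g : G, g • x = y) {A : Subgroup G} {z : Z} (hA : MulAction.stabilizer G x = A)
    (hz : X.map x = z) (h : A ≤ MulAction.stabilizer G z) : Iso (orb A z h) X := by
  subst hA hz
  refine ⟨Equiv.ofBijective (MulAction.ofQuotientStabilizer G x)
    ⟨MulAction.injective_ofQuotientStabilizer G x, fun y => ?_⟩, ?_, ?_⟩
  · obtain ⟨g, rfl⟩ := hx y
    exact ⟨(g : G ⧸ _), rfl⟩
  · exact fun g y => MulAction.ofQuotientStabilizer_smul G x g y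
  · rintro ⟨g⟩
    exact X.map_smul g x

theorem stabilizer_le (X : SetOver G Z) (x : X.carrier) :
    MulAction.stabilizer G x ≤ MulAction.stabilizer G (X.map x) := by
  intro g hg
  rw [MulAction.mem_stabilizer_iff] at hg ⊢
  rw [← X.map_smul, hg]

/-- Induction principle: finite `G`-sets over `Z` are built from orbits by disjoint unions. -/
theorem induction [Finite G] {P : SetOver G Z → Prop} (iso : ∀ X Y, Iso X Y → P X → P Y)
    (empty : ∀ X : SetOver G Z, IsEmpty X.carrier → P X) (sum : ∀ X Y, P X → P Y → P (X.sum Y))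
    (orb : ∀ A z h, P (orb A z h)) (X : SetOver G Z) : P X := by
  induction hn : Nat.card X.carrier using Nat.strong_induction_on generalizing X with
  | _ n ih =>
    by_cases hX : IsEmpty X.carrier
    · exact empty X hX
    obtain ⟨x⟩ := not_isEmpty_iff.1 hX
    have hp : ∀ (g : G) (y : X.carrier), y ∈ MulAction.orbit G x → g • y ∈ MulAction.orbit G x :=
      fun g y hy => hy.elim fun g' h => ⟨g * g', by simp only [mul_smul, ← h]⟩
    have hp' : ∀ (g : G) (y : X.carrier), ¬ y ∈ MulAction.orbit G x →
        ¬ g • y ∈ MulAction.orbit G x :=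
      fun g y hy h => hy (by simpa using hp g⁻¹ _ h)
    refine iso _ _ (X.iso_restrict_sum _ hp hp') (sum _ _ ?_ (ih _ ?_ _ rfl))
    · refine iso _ _ (iso_of_transitive (X.restrict _ hp) ⟨x, MulAction.mem_orbit_self x⟩ ?_ rfl rfl
        (stabilizer_le (X.restrict _ hp) _)) (orb _ _ _)
      rintro ⟨y, g, rfl⟩
      exact ⟨g, rfl⟩
    · rw [← hn]
      exact Finite.card_subtype_lt (x := x) (not_not.2 (MulAction.mem_orbit_self x))

/-- A function on finite `G`-sets over `Z` is additive if it is invariant under isomorphisms and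
turns disjoint unions into sums. -/
structure IsAdditive {N : Type*} [Add N] (F : SetOver G Z → N) : Prop where
  iso : ∀ X Y, Iso X Y → F X = F Y
  sum : ∀ X Y, F (X.sum Y) = F X + F Y

theorem IsAdditive.empty {N : Type*} [AddCommGroup N] {F : SetOver G Z → N} (hF : IsAdditive F)
    (X : SetOver G Z) (hX : IsEmpty X.carrier) : F X = 0 := by
  have h : Iso (X.sum X) X :=
    ⟨@Equiv.equivOfIsEmpty _ _ (isEmpty_sum.2 ⟨hX, hX⟩) hX,
      fun _ x => (isEmpty_sum.2 ⟨hX, hX⟩).elim x, fun x => (isEmpty_sum.2 ⟨hX, hX⟩).elim x⟩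
  have := hF.iso _ _ h
  rwa [hF.sum, add_eq_left] at this

end SetOver

/-- Pairs `(A, z)` with `A` a subgroup fixing `z`. -/
abbrev FixedPair (G : Type u) [Group G] (Z : Type u) [MulAction G Z] : Type u :=
  {p : Subgroup G × Z // p.1 ≤ MulAction.stabilizer G p.2}

/-- Simultaneous conjugation of pairs `(A, z)`. -/
instance fixedPairSetoid (G : Type u) [Group G] (Z : Type u) [MulAction G Z] :
    Setoid (FixedPair G Z) where
  r p q := ∃ g : G, q.1.1 = conjSubgroup g p.1.1 ∧ q.1.2 = g • p.1.2
  iseqv :=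
    { refl := fun p => ⟨1, by simp [conjSubgroup]⟩
      symm := by
        rintro p q ⟨g, h1, h2⟩
        exact ⟨g⁻¹, by simp [conjSubgroup, h1, h2]⟩
      trans := by
        rintro p q r ⟨g, h1, h2⟩ ⟨g', h1', h2'⟩
        exact ⟨g' * g, by simp [conjSubgroup, h1, h2, h1', h2', mul_smul]⟩ }

/-- Isomorphism types of transitive `G`-sets over `Z`. -/
abbrev OrbitType (G : Type u) [Group G] (Z : Type u) [MulAction G Z] : Type u :=
  Quotient (fixedPairSetoid G Z)

namespace SetOver

variable {G : Type u} [Group G] {Z : Type u} [MulAction G Z]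

/-- The isomorphism type of the orbit of a point. -/
def orbitType (X : SetOver G Z) (x : X.carrier) : OrbitType G Z :=
  Quotient.mk (fixedPairSetoid G Z) ⟨(MulAction.stabilizer G x, X.map x), X.stabilizer_le x⟩

theorem stabilizer_smul_conj {X : Type*} [MulAction G X] (g : G) (x : X) :
    MulAction.stabilizer G (g • x) = conjSubgroup g (MulAction.stabilizer G x) :=
  MulAction.stabilizer_smul_eq_stabilizer_map_conj g x

theorem orbitType_smul (X : SetOver G Z) (g : G) (x : X.carrier) :
    X.orbitType (g • x) = X.orbitType x :=
  (Quotient.sound (s := fixedPairSetoid G Z) ⟨g, stabilizer_smul_conj g x, X.map_smul g x⟩).symm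

theorem orbitType_eq_of_iso {X Y : SetOver G Z} (e : X.carrier ≃ Y.carrier)
    (he : ∀ (g : G) (x : X.carrier), e (g • x) = g • e x) (hm : ∀ x, Y.map (e x) = X.map x)
    (x : X.carrier) : Y.orbitType (e x) = X.orbitType x := by
  have h : MulAction.stabilizer G (e x) = MulAction.stabilizer G x := by
    ext g
    rw [MulAction.mem_stabilizer_iff, MulAction.mem_stabilizer_iff, ← he, e.apply_eq_iff_eq]
  unfold orbitType
  congr 2
  exact Prod.ext h (hm x)

end SetOver

/-- The Burnside module `RB(Z)` of finite `G`-sets over `Z`, as the free module on the isomorphism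
types of transitive ones. -/
def BurnsideModule (R : Type v) [CommRing R] (G : Type u) [Group G] (Z : Type u) [MulAction G Z] :
    Type (max u v) :=
  OrbitType G Z →₀ R

namespace BurnsideModule

variable (R : Type v) [CommRing R] {G : Type u} [Group G] {Z : Type u} [MulAction G Z]

noncomputable instance : AddCommGroup (BurnsideModule R G Z) :=
  inferInstanceAs (AddCommGroup (OrbitType G Z →₀ R))

noncomputable instance : Module R (BurnsideModule R G Z) :=
  inferInstanceAs (Module R (OrbitType G Z →₀ R))

/-- The basis of `RB(Z)` given by the transitive `G`-sets over `Z`. -/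
noncomputable def basis : Module.Basis (OrbitType G Z) R (BurnsideModule R G Z) :=
  Finsupp.basisSingleOne

instance : Module.Free R (BurnsideModule R G Z) := Module.Free.of_basis (basis R)

instance [Finite G] [Finite Z] : Module.Finite R (BurnsideModule R G Z) :=
  Module.Finite.of_basis (basis R)

/-- The class in `RB(Z)` of a finite `G`-set over `Z`. -/
noncomputable def cl (X : SetOver G Z) : BurnsideModule R G Z :=
  ∑ᶠ o : MulAction.orbitRel.Quotient G X.carrier, basis R (X.orbitType o.out)

/-- The class of `X` can be computed from any system of representatives of the orbits of `X`. -/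
theorem cl_eq_sum {X : SetOver G Z} {I : Type*} [Fintype I] (x : I → X.carrier)
    (inj : ∀ i j (g : G), g • x i = x j → i = j) (surj : ∀ y, ∃ i, ∃ g : G, g • x i = y) :
    cl R X = ∑ i, basis R (X.orbitType (x i)) := by
  have hx : Function.Bijective
      (fun i => (Quotient.mk _ (x i) : MulAction.orbitRel.Quotient G X.carrier)) := by
    constructor
    · intro i j h
      obtain ⟨g, hg⟩ := MulAction.orbitRel_apply.1 (Quotient.exact h)
      exact (inj j i g hg).symm
    · rintro ⟨y⟩
      obtain ⟨i, g, rfl⟩ := surj y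
      exact ⟨i, Quotient.sound (MulAction.orbitRel_apply.2 ⟨g⁻¹, inv_smul_smul g (x i)⟩)⟩
  unfold cl
  rw [← finsum_comp_equiv (Equiv.ofBijective _ hx), finsum_eq_sum_of_fintype]
  refine Finset.sum_congr rfl fun i _ => ?_
  obtain ⟨g, hg⟩ : MulAction.orbitRel G X.carrier _ _ :=
    Quotient.mk_out (s := MulAction.orbitRel G X.carrier) (x i)
  rw [Equiv.ofBijective_apply, ← hg]
  exact congrArg (basis R) (X.orbitType_smul g (x i))

/-- Every finite `G`-set has a system of representatives of its orbits. -/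
theorem _root_.SetOver.exists_reps (X : SetOver G Z) :
    ∃ (I : Type u) (_ : Fintype I) (x : I → X.carrier),
      (∀ i j (g : G), g • x i = x j → i = j) ∧ ∀ y, ∃ i, ∃ g : G, g • x i = y := by
  refine ⟨MulAction.orbitRel.Quotient G X.carrier, Fintype.ofFinite _, fun o => o.out, ?_, ?_⟩
  · intro i j g h
    rw [← i.out_eq, ← j.out_eq]
    exact (Quotient.sound (MulAction.orbitRel_apply.2 ⟨g, h⟩)).symm
  · intro y
    obtain ⟨g, hg⟩ := MulAction.orbitRel_apply.1
      (Quotient.mk_out (s := MulAction.orbitRel G X.carrier) y)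
    exact ⟨Quotient.mk _ y, g⁻¹, by rw [inv_smul_eq_iff]; exact hg.symm⟩

theorem cl_isAdditive : SetOver.IsAdditive (cl R : SetOver G Z → BurnsideModule R G Z) where
  iso := by
    rintro X Y ⟨e, he, hm⟩
    obtain ⟨I, _, x, inj, surj⟩ := X.exists_reps
    rw [cl_eq_sum R x inj surj, cl_eq_sum R (X := Y) (fun i => e (x i))]
    · exact Finset.sum_congr rfl fun o _ => by rw [SetOver.orbitType_eq_of_iso e he hm]
    · intro i j g h
      rw [← he, e.apply_eq_iff_eq] at h
      exact inj i j g h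
    · intro y
      obtain ⟨i, g, h⟩ := surj (e.symm y)
      exact ⟨i, g, by rw [← he, h, e.apply_symm_apply]⟩
  sum := by
    intro X Y
    obtain ⟨I, _, x, inj, surj⟩ := X.exists_reps
    obtain ⟨J, _, y, inj', surj'⟩ := Y.exists_reps
    rw [cl_eq_sum R x inj surj, cl_eq_sum R y inj' surj', cl_eq_sum R (X := X.sum Y) (I := I ⊕ J)
        (Sum.elim (fun i => Sum.inl (x i)) (fun j => Sum.inr (y j))), Fintype.sum_sum_type]
    · congr 1 <;> refine Finset.sum_congr rfl fun o _ => congrArg _ ?_ <;>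
      · unfold SetOver.orbitType
        congr 2
        refine Prod.ext ?_ rfl
        ext g
        first
          | exact Sum.inl_injective.eq_iff
          | exact Sum.inr_injective.eq_iff
    · rintro (i | i) (j | j) g h
      · exact congrArg _ (inj i j g (Sum.inl_injective h))
      · cases h
      · cases h
      · exact congrArg _ (inj' i j g (Sum.inr_injective h))
    · rintro (z | z)
      · obtain ⟨i, g, h⟩ := surj z
        exact ⟨Sum.inl i, g, congrArg Sum.inl h⟩
      · obtain ⟨i, g, h⟩ := surj' z
        exact ⟨Sum.inr i, g, congrArg Sum.inr h⟩

theorem cl_of_transitive (X : SetOver G Z) (x : X.carrier) (hx : ∀ y, ∃ g : G, g • x = y) :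
    cl R X = basis R (X.orbitType x) := by
  rw [cl_eq_sum R (fun _ : Unit => x) (fun _ _ _ _ => rfl) fun y => ⟨(), hx y⟩,
    Finset.univ_unique, Finset.sum_singleton]

variable [Finite G]

theorem cl_orb (A : Subgroup G) (z : Z) (h : A ≤ MulAction.stabilizer G z) :
    cl R (SetOver.orb A z h) = basis R (Quotient.mk (fixedPairSetoid G Z) ⟨(A, z), h⟩) := by
  rw [cl_of_transitive R (SetOver.orb A z h) SetOver.orbPt SetOver.exists_smul_orbPt]
  unfold SetOver.orbitType
  congr 3
  exact Prod.ext (SetOver.stabilizer_orbPt (h := h)) (SetOver.map_orbPt (h := h))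

variable {R} {N : Type*} [AddCommGroup N] [Module R N]

/-- Linear maps out of `RB(Z)` which agree on transitive `G`-sets are equal. -/
theorem hom_ext {f f' : BurnsideModule R G Z →ₗ[R] N}
    (h : ∀ A z hA, f (cl R (SetOver.orb A z hA)) = f' (cl R (SetOver.orb A z hA))) : f = f' := by
  refine (basis R).ext fun q => ?_
  obtain ⟨⟨⟨A, z⟩, hA⟩, rfl⟩ := q.exists_rep
  rw [← cl_orb]
  exact h A z hA

variable (R) in
/-- The linear map out of `RB(Z)` given by an additive function: it is prescribed on the orbits
`G / A → Z`, for a choice of `(A, z)` in each conjugacy class. -/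
noncomputable def lift (F : SetOver G Z → N) : BurnsideModule R G Z →ₗ[R] N :=
  (basis R).constr R fun q => F (SetOver.orb q.out.1.1 q.out.1.2 q.out.2)

/-- The universal property of `RB(Z)`. -/
theorem lift_cl {F : SetOver G Z → N} (hF : SetOver.IsAdditive F) (X : SetOver G Z) :
    lift R F (cl R X) = F X := by
  induction X using SetOver.induction with
  | iso X Y h ih => rw [← (cl_isAdditive R).iso X Y h, ih, hF.iso X Y h]
  | empty X hX => rw [(cl_isAdditive R).empty X hX, hF.empty X hX, map_zero]
  | sum X Y hX hY => rw [(cl_isAdditive R).sum, hF.sum, map_add, hX, hY]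
  | orb A z h =>
    rw [cl_orb, lift, Module.Basis.constr_basis]
    obtain ⟨g, h1, h2⟩ : fixedPairSetoid G Z _ _ :=
      Quotient.mk_out (s := fixedPairSetoid G Z) ⟨(A, z), h⟩
    refine hF.iso _ _ (SetOver.iso_of_transitive _ (g⁻¹ • SetOver.orbPt) (fun y => ?_) ?_ ?_ _)
    · obtain ⟨g', rfl⟩ := SetOver.exists_smul_orbPt y
      exact ⟨g' * g, by rw [smul_smul, mul_assoc, mul_inv_cancel, mul_one]⟩
    · rw [SetOver.stabilizer_smul_conj, SetOver.stabilizer_orbPt, conjSubgroup, map_inv,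
        inv_smul_eq_iff]
      exact h1
    · rw [SetOver.map_smul, SetOver.map_orbPt, inv_smul_eq_iff]
      exact h2

end BurnsideModule

/-! ### The algebra of spans -/

namespace SetOver

variable {G : Type u} [Group G] {Z : Type u} [MulAction G Z]

/-- Composition of spans: the pullback of the right leg of `X` and the left leg of `Y`. -/
def comp (X Y : SetOver G (Z × Z)) : SetOver G (Z × Z) where
  carrier := {p : X.carrier × Y.carrier // (X.map p.1).2 = (Y.map p.2).1}
  action := subtypeAction _ fun g p h => by
    rw [Prod.smul_fst, Prod.smul_snd, X.map_smul, Y.map_smul, Prod.smul_fst, Prod.smul_snd, h]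
  map p := ((X.map p.1.1).1, (Y.map p.1.2).2)
  map_smul g p := Prod.ext (Prod.ext_iff.1 (X.map_smul g p.1.1)).1
    (Prod.ext_iff.1 (Y.map_smul g p.1.2)).2

/-- The point of a composite span given by two points of its factors. -/
def compPt {X Y : SetOver G (Z × Z)} (x : X.carrier) (y : Y.carrier)
    (h : (X.map x).2 = (Y.map y).1) : (X.comp Y).carrier :=
  ⟨(x, y), h⟩

section compPt

variable {X Y : SetOver G (Z × Z)} {x : X.carrier} {y : Y.carrier} {h : (X.map x).2 = (Y.map y).1}

theorem map_compPt : (X.comp Y).map (compPt x y h) = ((X.map x).1, (Y.map y).2) := rfl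

theorem smul_compPt_eq_iff {g : G} {x' : X.carrier} {y' : Y.carrier}
    {h' : (X.map x').2 = (Y.map y').1} :
    g • compPt x y h = compPt x' y' h' ↔ g • x = x' ∧ g • y = y' :=
  Subtype.ext_iff.trans Prod.ext_iff

theorem stabilizer_compPt :
    MulAction.stabilizer G (compPt x y h) = MulAction.stabilizer G x ⊓ MulAction.stabilizer G y := by
  ext g
  exact smul_compPt_eq_iff

theorem exists_compPt (p : (X.comp Y).carrier) : ∃ x y h, p = compPt x y h :=
  ⟨p.1.1, p.1.2, p.2, rfl⟩

end compPt

/-- The identity span. -/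
def diag (G : Type u) [Group G] (Z : Type u) [MulAction G Z] [Finite Z] : SetOver G (Z × Z) where
  carrier := Z
  map z := (z, z)
  map_smul _ _ := rfl

theorem comp_iso {X X' Y Y' : SetOver G (Z × Z)} :
    Iso X X' → Iso Y Y' → Iso (X.comp Y) (X'.comp Y') := by
  rintro ⟨e, he, hm⟩ ⟨f, hf, hn⟩
  refine ⟨(Equiv.prodCongr e f).subtypeEquiv fun p => ?_, fun g p => ?_, fun p => ?_⟩
  · simp [hm, hn]
  · exact Subtype.ext (Prod.ext (he g _) (hf g _))
  · exact Prod.ext (Prod.ext_iff.1 (hm p.1.1)).1 (Prod.ext_iff.1 (hn p.1.2)).2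

theorem Iso.refl (X : SetOver G Z) : Iso X X :=
  ⟨Equiv.refl _, fun _ _ => rfl, fun _ => rfl⟩

theorem comp_sum_iso (X Y Y' : SetOver G (Z × Z)) :
    Iso (X.comp (Y.sum Y')) ((X.comp Y).sum (X.comp Y')) := by
  refine ⟨⟨fun p => match p with
      | ⟨(x, .inl y), h⟩ => .inl ⟨(x, y), h⟩
      | ⟨(x, .inr y), h⟩ => .inr ⟨(x, y), h⟩, fun p => match p with
      | .inl p => ⟨(p.1.1, .inl p.1.2), p.2⟩
      | .inr p => ⟨(p.1.1, .inr p.1.2), p.2⟩, ?_, ?_⟩, ?_, ?_⟩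
  · rintro ⟨⟨x, y | y⟩, h⟩ <;> rfl
  · rintro (p | p) <;> rfl
  · rintro g ⟨⟨x, y | y⟩, h⟩ <;> rfl
  · rintro ⟨⟨x, y | y⟩, h⟩ <;> rfl

theorem sum_comp_iso (X X' Y : SetOver G (Z × Z)) :
    Iso ((X.sum X').comp Y) ((X.comp Y).sum (X'.comp Y)) := by
  refine ⟨⟨fun p => match p with
      | ⟨(.inl x, y), h⟩ => .inl ⟨(x, y), h⟩
      | ⟨(.inr x, y), h⟩ => .inr ⟨(x, y), h⟩, fun p => match p with
      | .inl p => ⟨(.inl p.1.1, p.1.2), p.2⟩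
      | .inr p => ⟨(.inr p.1.1, p.1.2), p.2⟩, ?_, ?_⟩, ?_, ?_⟩
  · rintro ⟨⟨x | x, y⟩, h⟩ <;> rfl
  · rintro (p | p) <;> rfl
  · rintro g ⟨⟨x | x, y⟩, h⟩ <;> rfl
  · rintro ⟨⟨x | x, y⟩, h⟩ <;> rfl

theorem comp_assoc_iso (X Y W : SetOver G (Z × Z)) :
    Iso ((X.comp Y).comp W) (X.comp (Y.comp W)) :=
  ⟨⟨fun p => ⟨(p.1.1.1.1, ⟨(p.1.1.1.2, p.1.2), p.2⟩), p.1.1.2⟩,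
    fun p => ⟨(⟨(p.1.1, p.1.2.1.1), p.2⟩, p.1.2.1.2), p.1.2.2⟩, fun _ => rfl, fun _ => rfl⟩,
    fun _ _ => rfl, fun _ => rfl⟩

theorem diag_comp_iso [Finite Z] (X : SetOver G (Z × Z)) : Iso ((diag G Z).comp X) X :=
  ⟨⟨fun p => p.1.2, fun x => ⟨((X.map x).1, x), rfl⟩,
    fun p => Subtype.ext (Prod.ext p.2.symm rfl), fun _ => rfl⟩, fun _ _ => rfl,
    fun p => Prod.ext p.2.symm rfl⟩

theorem comp_diag_iso [Finite Z] (X : SetOver G (Z × Z)) : Iso (X.comp (diag G Z)) X :=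
  ⟨⟨fun p => p.1.1, fun x => ⟨(x, (X.map x).2), rfl⟩,
    fun p => Subtype.ext (Prod.ext rfl p.2), fun _ => rfl⟩, fun _ _ => rfl,
    fun p => Prod.ext rfl p.2⟩

end SetOver

namespace BurnsideModule

open SetOver

variable (R : Type v) [CommRing R] {G : Type u} [Group G] [Finite G] {Z : Type u} [MulAction G Z]

omit [Finite G] in
theorem cl_comp_isAdditive (X : SetOver G (Z × Z)) :
    IsAdditive (fun Y => cl R (X.comp Y)) where
  iso _ _ h := (cl_isAdditive R).iso _ _ (comp_iso (Iso.refl X) h)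
  sum Y Y' := by
    rw [(cl_isAdditive R).iso _ _ (comp_sum_iso X Y Y'), (cl_isAdditive R).sum]

theorem lift_comp_isAdditive :
    IsAdditive (fun X : SetOver G (Z × Z) => lift R fun Y => cl R (X.comp Y)) where
  iso _ _ h := hom_ext fun A z hA => by
    rw [lift_cl (cl_comp_isAdditive R _), lift_cl (cl_comp_isAdditive R _)]
    exact (cl_isAdditive R).iso _ _ (comp_iso h (Iso.refl _))
  sum X X' := hom_ext fun A z hA => by
    rw [LinearMap.add_apply, lift_cl (cl_comp_isAdditive R _), lift_cl (cl_comp_isAdditive R _),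
      lift_cl (cl_comp_isAdditive R _), (cl_isAdditive R).iso _ _ (sum_comp_iso X X' _),
      (cl_isAdditive R).sum]

/-- Composition of spans, extended bilinearly. -/
noncomputable def mulHom :
    BurnsideModule R G (Z × Z) →ₗ[R] BurnsideModule R G (Z × Z) →ₗ[R]
      BurnsideModule R G (Z × Z) :=
  lift R fun X => lift R fun Y => cl R (X.comp Y)

theorem mulHom_cl (X Y : SetOver G (Z × Z)) :
    mulHom R (cl R X) (cl R Y) = cl R (X.comp Y) := by
  rw [mulHom, lift_cl (lift_comp_isAdditive R), lift_cl (cl_comp_isAdditive R X)]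

theorem mulHom_assoc (a b c : BurnsideModule R G (Z × Z)) :
    mulHom R (mulHom R a b) c = mulHom R a (mulHom R b c) := by
  suffices h : (mulHom R).flip c ∘ₗ (mulHom R).flip b = (mulHom R).flip (mulHom R b c) from
    LinearMap.congr_fun h a
  refine hom_ext fun A z hA => ?_
  set x := cl R (orb A z hA) with hx
  suffices h : (mulHom R).flip c ∘ₗ mulHom R x = mulHom R x ∘ₗ (mulHom R).flip c from
    LinearMap.congr_fun h b
  refine hom_ext fun A' z' hA' => ?_
  set y := cl R (orb A' z' hA') with hy
  suffices h : mulHom R (mulHom R x y) = mulHom R x ∘ₗ mulHom R y from LinearMap.congr_fun h c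
  refine hom_ext fun A'' z'' hA'' => ?_
  rw [LinearMap.comp_apply, hx, hy, mulHom_cl, mulHom_cl, mulHom_cl, mulHom_cl]
  exact (cl_isAdditive R).iso _ _ (comp_assoc_iso _ _ _)

variable [Finite Z]

theorem one_mulHom (a : BurnsideModule R G (Z × Z)) : mulHom R (cl R (diag G Z)) a = a := by
  suffices h : mulHom R (cl R (diag G Z)) = LinearMap.id from LinearMap.congr_fun h a
  refine hom_ext fun A z hA => ?_
  rw [mulHom_cl]
  exact (cl_isAdditive R).iso _ _ (diag_comp_iso _)

theorem mulHom_one (a : BurnsideModule R G (Z × Z)) : mulHom R a (cl R (diag G Z)) = a := by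
  suffices h : (mulHom R).flip (cl R (diag G Z)) = LinearMap.id from LinearMap.congr_fun h a
  refine hom_ext fun A z hA => ?_
  rw [LinearMap.flip_apply, mulHom_cl]
  exact (cl_isAdditive R).iso _ _ (comp_diag_iso _)

/-- The algebra of spans on `Z`: the product is composition of spans. -/
noncomputable instance : Ring (BurnsideModule R G (Z × Z)) where
  __ := (inferInstance : AddCommGroup (BurnsideModule R G (Z × Z)))
  mul a b := mulHom R a b
  one := cl R (diag G Z)
  left_distrib a b c := map_add (mulHom R a) b c
  right_distrib a b c := by
    change mulHom R (a + b) c = mulHom R a c + mulHom R b c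
    rw [map_add, LinearMap.add_apply]
  zero_mul a := by
    change mulHom R 0 a = 0
    rw [map_zero, LinearMap.zero_apply]
  mul_zero a := map_zero (mulHom R a)
  mul_assoc a b c := mulHom_assoc R a b c
  one_mul a := one_mulHom R a
  mul_one a := mulHom_one R a

noncomputable instance : Algebra R (BurnsideModule R G (Z × Z)) :=
  Algebra.ofModule (fun r a b => by
      change mulHom R (r • a) b = r • mulHom R a b
      rw [LinearMap.map_smul, LinearMap.smul_apply])
    fun r a b => (mulHom R a).map_smul r b 

theorem cl_mul_cl (X Y : SetOver G (Z × Z)) : cl R X * cl R Y = cl R (X.comp Y) :=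
  mulHom_cl R X Y

theorem one_def : (1 : BurnsideModule R G (Z × Z)) = cl R (diag G Z) := rfl

end BurnsideModule

/-! ### The action on cosets -/

/-- The `G`-set of all left cosets of all subgroups of `G`. -/
abbrev Cosets (G : Type u) [Group G] : Type u := Σ H : Subgroup G, G ⧸ H

namespace Cosets

variable {G : Type u} [Group G]

/-- The coset `gH`. -/
def pt (H : Subgroup G) (g : G) : Cosets G := ⟨H, (g : G ⧸ H)⟩

theorem smul_pt (x g : G) (H : Subgroup G) : x • pt H g = pt H (x * g) := rfl

theorem pt_eq_iff {H : Subgroup G} {g g' : G} : pt H g = pt H g' ↔ g⁻¹ * g' ∈ H := by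
  unfold pt
  rw [Sigma.mk.injEq, heq_eq_eq, QuotientGroup.eq]
  simp

theorem mem_conj_iff {g x : G} {H : Subgroup G} : x ∈ conjSubgroup g H ↔ g⁻¹ * x * g ∈ H := by
  rw [conjSubgroup, Subgroup.mem_pointwise_smul_iff_inv_smul_mem, ← map_inv, MulAut.smul_def,
    MulAut.conj_apply, inv_inv]

theorem stabilizer_pt (H : Subgroup G) (g : G) :
    MulAction.stabilizer G (pt H g) = conjSubgroup g H := by
  ext x
  rw [MulAction.mem_stabilizer_iff, smul_pt, pt_eq_iff, mem_conj_iff, ← inv_mem_iff]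
  simp [mul_assoc]

theorem stabilizer_pt_one (H : Subgroup G) : MulAction.stabilizer G (pt H 1) = H := by
  rw [stabilizer_pt, conjSubgroup, map_one, one_smul]

end Cosets

theorem stabilizer_prod {G X Y : Type*} [Group G] [MulAction G X] [MulAction G Y] (x : X) (y : Y) :
    MulAction.stabilizer G (x, y) = MulAction.stabilizer G x ⊓ MulAction.stabilizer G y := by
  ext g
  simp [MulAction.mem_stabilizer_iff, Subgroup.mem_inf]

namespace BurnsideModule

open SetOver

variable (R : Type v) [CommRing R] {G : Type u} [Group G] [Finite G] {Z : Type u} [MulAction G Z]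

open Classical in
/-- The transitive span with base point of stabilizer `A` mapping to `(z, w)`; it is `0` if `A` does
not fix `z` and `w`. -/
noncomputable def span (A : Subgroup G) (z w : Z) : BurnsideModule R G (Z × Z) :=
  if h : A ≤ MulAction.stabilizer G (z, w) then cl R (orb A (z, w) h) else 0

variable {R}

theorem span_of_le {A : Subgroup G} {z w : Z} (h : A ≤ MulAction.stabilizer G (z, w)) :
    span R A z w = cl R (orb A (z, w) h) := dif_pos h

theorem span_smul (g : G) (A : Subgroup G) (z w : Z) :
    span R (conjSubgroup g A) (g • z) (g • w) = span R A z w := by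
  have key : conjSubgroup g A ≤ MulAction.stabilizer G (g • z, g • w) ↔
      A ≤ MulAction.stabilizer G (z, w) := by
    rw [← Prod.smul_mk, stabilizer_smul_conj, conjSubgroup, conjSubgroup,
      Subgroup.pointwise_smul_le_pointwise_smul_iff]
  by_cases h : A ≤ MulAction.stabilizer G (z, w)
  · rw [span_of_le h, span_of_le (key.2 h), cl_orb, cl_orb]
    exact congrArg _ (Quotient.sound (s := fixedPairSetoid G (Z × Z)) ⟨g, rfl, rfl⟩).symm
  · rw [span, span, dif_neg h, dif_neg (mt key.1 h)]

theorem basis_orbitType (X : SetOver G (Z × Z)) (x : X.carrier) :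
    basis R (X.orbitType x) =
      span R (MulAction.stabilizer G x) (X.map x).1 (X.map x).2 := by
  rw [span_of_le (X.stabilizer_le x), cl_orb]
  rfl

/-- Composition of transitive spans along an isomorphism `G / A ≅ G • z₂`. -/
theorem span_mul_span_left [Finite Z] {A B : Subgroup G} {z₁ z₂ z₃ : Z}
    (h₁ : A ≤ MulAction.stabilizer G z₁) (h₂ : MulAction.stabilizer G z₂ = A) (h : B ≤ A)
    (h₃ : B ≤ MulAction.stabilizer G z₃) :
    span R A z₁ z₂ * span R B z₂ z₃ = span R B z₁ z₃ := by
  have h12 : A ≤ MulAction.stabilizer G (z₁, z₂) := by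
    rw [stabilizer_prod]; exact le_inf h₁ h₂.ge
  have h23 : B ≤ MulAction.stabilizer G (z₂, z₃) := by
    rw [stabilizer_prod, h₂]; exact le_inf h h₃
  rw [span_of_le h12, span_of_le h23, cl_mul_cl, cl_of_transitive R _
    (compPt orbPt orbPt (by rw [map_orbPt, map_orbPt])), basis_orbitType, stabilizer_compPt]
  · simp only [stabilizer_orbPt, map_compPt, map_orbPt, inf_eq_right.2 h]
  · intro y
    obtain ⟨p, q, hpq, rfl⟩ := exists_compPt y
    obtain ⟨a, rfl⟩ := exists_smul_orbPt p
    obtain ⟨b, rfl⟩ := exists_smul_orbPt q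
    refine ⟨b, smul_compPt_eq_iff.2 ⟨?_, rfl⟩⟩
    rw [SetOver.map_smul, SetOver.map_smul, map_orbPt, map_orbPt] at hpq
    rw [smul_orbPt_eq_iff, ← h₂, MulAction.mem_stabilizer_iff, mul_smul, inv_smul_eq_iff]
    exact hpq

/-- Composition of transitive spans along an isomorphism `G / B ≅ G • z₂`. -/
theorem span_mul_span_right [Finite Z] {A B : Subgroup G} {z₁ z₂ z₃ : Z}
    (h₁ : A ≤ MulAction.stabilizer G z₁) (h₂ : MulAction.stabilizer G z₂ = B) (h : A ≤ B)
    (h₃ : B ≤ MulAction.stabilizer G z₃) :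
    span R A z₁ z₂ * span R B z₂ z₃ = span R A z₁ z₃ := by
  have h12 : A ≤ MulAction.stabilizer G (z₁, z₂) := by
    rw [stabilizer_prod, h₂]; exact le_inf h₁ h
  have h23 : B ≤ MulAction.stabilizer G (z₂, z₃) := by
    rw [stabilizer_prod]; exact le_inf h₂.ge h₃
  rw [span_of_le h12, span_of_le h23, cl_mul_cl, cl_of_transitive R _
    (compPt orbPt orbPt (by rw [map_orbPt, map_orbPt])), basis_orbitType, stabilizer_compPt]
  · simp only [stabilizer_orbPt, map_compPt, map_orbPt, inf_eq_left.2 h]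
  · intro y
    obtain ⟨p, q, hpq, rfl⟩ := exists_compPt y
    obtain ⟨a, rfl⟩ := exists_smul_orbPt p
    obtain ⟨b, rfl⟩ := exists_smul_orbPt q
    refine ⟨a, smul_compPt_eq_iff.2 ⟨rfl, ?_⟩⟩
    rw [SetOver.map_smul, SetOver.map_smul, map_orbPt, map_orbPt] at hpq
    rw [smul_orbPt_eq_iff, ← h₂, MulAction.mem_stabilizer_iff, mul_smul, inv_smul_eq_iff]
    exact hpq.symm

end BurnsideModule

namespace BurnsideModule

open SetOver Cosets

variable {R : Type v} [CommRing R] {G : Type u} [Group G] [Finite G]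

theorem span_mul_span_of_ne (A B : Subgroup G) {z₁ z₂ z₃ z₄ : Cosets G} (h : z₂.1 ≠ z₃.1) :
    span R A z₁ z₂ * span R B z₃ z₄ = 0 := by
  by_cases h12 : A ≤ MulAction.stabilizer G (z₁, z₂)
  swap
  · rw [span, dif_neg h12, zero_mul]
  by_cases h34 : B ≤ MulAction.stabilizer G (z₃, z₄)
  swap
  · rw [span.eq_1 R B, dif_neg h34, mul_zero]
  rw [span_of_le h12, span_of_le h34, cl_mul_cl]
  refine (cl_isAdditive R).empty _ ⟨?_⟩
  intro y
  obtain ⟨p, q, hpq, rfl⟩ := exists_compPt y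
  obtain ⟨a, rfl⟩ := exists_smul_orbPt p
  obtain ⟨b, rfl⟩ := exists_smul_orbPt q
  rw [SetOver.map_smul, SetOver.map_smul, map_orbPt, map_orbPt] at hpq
  have hfst := congrArg Sigma.fst (show a • z₂ = b • z₃ from hpq)
  exact h hfst

/-- The base cosets `H` represent the orbits of the `G`-set of all cosets. -/
theorem one_eq_sum_span [Fintype (Subgroup G)] :
    (1 : BurnsideModule R G (Cosets G × Cosets G)) = ∑ H, span R H (pt H 1) (pt H 1) := by
  rw [one_def, cl_eq_sum R (X := diag G (Cosets G)) fun H => pt H 1]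
  · refine Finset.sum_congr rfl fun H _ => ?_
    refine (basis_orbitType (diag G (Cosets G)) (pt H 1 : Cosets G)).trans ?_
    change span R (MulAction.stabilizer G (pt H 1)) (pt H 1) (pt H 1) = _
    rw [stabilizer_pt_one]
  · exact fun H K g h => congrArg Sigma.fst h
  · rintro ⟨H, ⟨g⟩⟩
    exact ⟨H, g, congrArg (pt H) (mul_one g)⟩

/-- The pullback `G/L ×_{G/H} G/K` has one orbit for each double coset in `L \ H / K`, with
representatives `(L, hK)`. -/
theorem span_mul_span_mackey {H L K : Subgroup G} (hLH : L ≤ H) (hKH : K ≤ H)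
    [Fintype (DoubleCoset.Quotient (L.subgroupOf H : Set H) (K.subgroupOf H : Set H))] :
    span R L (pt L 1) (pt H 1) * span R K (pt H 1) (pt K 1) =
      ∑ x : DoubleCoset.Quotient (L.subgroupOf H : Set H) (K.subgroupOf H : Set H),
        span R (L ⊓ conjSubgroup (x.out : G) K) (pt L 1) (pt K (x.out : G)) := by
  have h12 : L ≤ MulAction.stabilizer G (pt L 1, pt H 1) := by
    rw [stabilizer_prod, stabilizer_pt_one, stabilizer_pt_one]; exact le_inf le_rfl hLH
  have h23 : K ≤ MulAction.stabilizer G (pt H 1, pt K 1) := by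
    rw [stabilizer_prod, stabilizer_pt_one, stabilizer_pt_one]; exact le_inf hKH le_rfl
  have hpt (h : H) : ((orb L (pt L 1, pt H 1) h12).map orbPt).2 =
      ((orb K (pt H 1, pt K 1) h23).map ((h : G) • orbPt)).1 := by
    rw [SetOver.map_smul, map_orbPt, map_orbPt, Prod.smul_fst, smul_pt, pt_eq_iff]
    simp
  rw [span_of_le h12, span_of_le h23, cl_mul_cl, cl_eq_sum R fun x :
    DoubleCoset.Quotient (L.subgroupOf H : Set H) (K.subgroupOf H : Set H) =>
    compPt orbPt ((x.out : G) • orbPt) (hpt x.out)]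
  · refine Finset.sum_congr rfl fun x _ => ?_
    rw [basis_orbitType, stabilizer_compPt, stabilizer_smul_conj, stabilizer_orbPt,
      stabilizer_orbPt]
    simp only [map_compPt, map_orbPt, SetOver.map_smul, Prod.smul_mk, smul_pt, mul_one]
  · intro x y g h
    obtain ⟨h1, h2⟩ := smul_compPt_eq_iff.1 h
    have hg : g ∈ L := by
      rw [← stabilizer_orbPt (h := h12)]
      exact h1
    have hk : (g * (x.out : G))⁻¹ * (y.out : G) ∈ K := by
      rw [smul_smul] at h2
      exact smul_orbPt_eq_iff.1 h2
    rw [← DoubleCoset.out_eq' _ _ x, ← DoubleCoset.out_eq' _ _ y, DoubleCoset.eq]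
    exact ⟨⟨g, hLH hg⟩, hg, ⟨_, hKH hk⟩, hk, Subtype.ext (by simp [mul_assoc])⟩
  · intro p
    obtain ⟨p, q, hpq, rfl⟩ := exists_compPt p
    obtain ⟨a, rfl⟩ := exists_smul_orbPt p
    obtain ⟨b, rfl⟩ := exists_smul_orbPt q
    have hab : a⁻¹ * b ∈ H := by
      rw [SetOver.map_smul, SetOver.map_smul, map_orbPt, map_orbPt] at hpq
      simpa [smul_pt, pt_eq_iff] using hpq
    obtain ⟨l, k, hl, hk, hx⟩ :=
      DoubleCoset.mk_out_eq_mul (L.subgroupOf H) (K.subgroupOf H) ⟨a⁻¹ * b, hab⟩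
    have hx' : ((DoubleCoset.mk (L.subgroupOf H) (K.subgroupOf H) ⟨a⁻¹ * b, hab⟩ :
        DoubleCoset.Quotient (L.subgroupOf H : Set H) (K.subgroupOf H : Set H)).out : G) =
        l * (a⁻¹ * b) * k := congrArg Subtype.val hx
    refine ⟨DoubleCoset.mk (L.subgroupOf H) (K.subgroupOf H) ⟨a⁻¹ * b, hab⟩, a * (l : G)⁻¹,
      smul_compPt_eq_iff.2 ⟨?_, ?_⟩⟩
    · rw [smul_orbPt_eq_iff]
      simpa using Subgroup.mem_subgroupOf.1 hl
    · rw [smul_smul, smul_orbPt_eq_iff, hx']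
      simpa [mul_assoc] using Subgroup.mem_subgroupOf.1 hk

end BurnsideModule

/-! ### The Mackey algebra is the algebra of spans -/

section Conj

variable {G : Type u} [Group G]

theorem conjSubgroup_conjSubgroup (g h : G) (H : Subgroup G) :
    conjSubgroup g (conjSubgroup h H) = conjSubgroup (g * h) H := by
  rw [conjSubgroup, conjSubgroup, conjSubgroup, smul_smul, map_mul]

theorem conjSubgroup_one (H : Subgroup G) : conjSubgroup 1 H = H := by
  rw [conjSubgroup, map_one, one_smul]

theorem conjSubgroup_inv_conjSubgroup (g : G) (H : Subgroup G) :
    conjSubgroup g⁻¹ (conjSubgroup g H) = H := by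
  rw [conjSubgroup_conjSubgroup, inv_mul_cancel, conjSubgroup_one]

theorem conjSubgroup_conjSubgroup_inv (g : G) (H : Subgroup G) :
    conjSubgroup g (conjSubgroup g⁻¹ H) = H := by
  rw [conjSubgroup_conjSubgroup, mul_inv_cancel, conjSubgroup_one]

theorem conjSubgroup_le_iff {g : G} {H K : Subgroup G} :
    conjSubgroup g H ≤ conjSubgroup g K ↔ H ≤ K :=
  Subgroup.pointwise_smul_le_pointwise_smul_iff

theorem conjSubgroup_of_mem {H : Subgroup G} {h : G} (hh : h ∈ H) : conjSubgroup h H = H :=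
  Subgroup.conj_smul_eq_self_of_mem hh

theorem conjSubgroup_inf (g : G) (H K : Subgroup G) :
    conjSubgroup g (H ⊓ K) = conjSubgroup g H ⊓ conjSubgroup g K :=
  Subgroup.smul_inf _ _ _

end Conj

namespace MackeyAlgebra

open SetOver Cosets BurnsideModule

section

variable (R : Type v) [CommRing R] {G : Type u} [Group G] [Finite G]

/-- The span attached to a generator: `t^K_H` is `G/K ← G/H = G/H`, `r^K_H` is `G/H = G/H → G/K`,
and `c_{g,H}` is `G/ᵍH ← G/H = G/H` with left leg `xH ↦ xg⁻¹ ᵍH`. -/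
noncomputable def genSpan : MackeyGen G → BurnsideModule R G (Cosets G × Cosets G)
  | .t K H _ => span R H (pt K 1) (pt H 1)
  | .r K H _ => span R H (pt H 1) (pt K 1)
  | .c g H => span R H (pt (conjSubgroup g H) g⁻¹) (pt H 1)

variable {R}

theorem span_mul_left {A B H K L : Subgroup G} {a b c : G} (hB : conjSubgroup b H = A)
    (h₁ : A ≤ conjSubgroup a L) (h₂ : B ≤ A) (h₃ : B ≤ conjSubgroup c K) :
    span R A (pt L a) (pt H b) * span R B (pt H b) (pt K c) = span R B (pt L a) (pt K c) :=
  span_mul_span_left (by rwa [stabilizer_pt]) (by rw [stabilizer_pt, hB]) h₂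
    (by rwa [stabilizer_pt])

theorem span_mul_right {A B H K L : Subgroup G} {a b c : G} (hB : conjSubgroup b H = B)
    (h₁ : A ≤ conjSubgroup a L) (h₂ : A ≤ B) (h₃ : B ≤ conjSubgroup c K) :
    span R A (pt L a) (pt H b) * span R B (pt H b) (pt K c) = span R A (pt L a) (pt K c) :=
  span_mul_span_right (by rwa [stabilizer_pt]) (by rw [stabilizer_pt, hB]) h₂
    (by rwa [stabilizer_pt])

theorem span_conj (g : G) (A H K : Subgroup G) (a b : G) :
    span R A (pt H a) (pt K b) = span R (conjSubgroup g A) (pt H (g * a)) (pt K (g * b)) :=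
  (span_smul g A (pt H a) (pt K b)).symm

theorem genSpan_mul_of_ne {a b : MackeyGen G} (h : a.source ≠ b.target) :
    genSpan R a * genSpan R b = 0 := by
  cases a <;> cases b <;> exact span_mul_span_of_ne _ _ h

/-- The product `t c r` of spans attached to `ᵍB ≤ H` and `B ≤ K`. -/
theorem span_tcr {H K B : Subgroup G} {g : G} (hK : B ≤ K) (hH : conjSubgroup g B ≤ H) :
    span R (conjSubgroup g B) (pt H 1) (pt (conjSubgroup g B) 1) *
      span R B (pt (conjSubgroup g B) g⁻¹) (pt B 1) * span R B (pt B 1) (pt K 1) =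
      span R B (pt H g⁻¹) (pt K 1) := by
  rw [mul_assoc, span_mul_left (conjSubgroup_one B) (by rw [conjSubgroup_inv_conjSubgroup]) le_rfl
    (by rwa [conjSubgroup_one]), span_conj g B, mul_inv_cancel, span_mul_left (conjSubgroup_one _)
    (by rwa [conjSubgroup_one]) le_rfl (by rwa [mul_one, conjSubgroup_le_iff]), span_conj g B,
    mul_inv_cancel]

theorem lift_genSpan_rel {x y : FreeAlgebra R (MackeyGen G)} (h : MackeyRel R x y) :
    FreeAlgebra.lift R (genSpan R) x = FreeAlgebra.lift R (genSpan R) y := by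
  cases h with
  | one =>
    have := Fintype.ofFinite (Subgroup G)
    rw [finsum_eq_sum_of_fintype, map_sum, map_one, one_eq_sum_span]
    exact Finset.sum_congr rfl fun H _ => by rw [freeT, FreeAlgebra.lift_ι_apply, genSpan]
  | t_self_eq_r_self H => simp only [freeT, freeR, FreeAlgebra.lift_ι_apply, genSpan]
  | t_self_eq_c H h hh =>
    simp only [freeT, freeC, FreeAlgebra.lift_ι_apply, genSpan]
    rw [conjSubgroup_of_mem hh]
    congr 1
    rw [pt_eq_iff]
    simpa using hh
  | t_trans L K H hKL hHK =>
    simp only [freeT, map_mul, FreeAlgebra.lift_ι_apply, genSpan]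
    exact span_mul_left (conjSubgroup_one K) (by rwa [conjSubgroup_one]) hHK
      (by rw [conjSubgroup_one])
  | r_trans L K H hKL hHK =>
    simp only [freeR, map_mul, FreeAlgebra.lift_ι_apply, genSpan]
    exact span_mul_right (conjSubgroup_one K) (by rw [conjSubgroup_one]) hHK
      (by rwa [conjSubgroup_one])
  | c_mul g' g H =>
    simp only [freeC, map_mul, FreeAlgebra.lift_ι_apply, genSpan]
    rw [span_conj g⁻¹ (conjSubgroup g H), conjSubgroup_inv_conjSubgroup, conjSubgroup_conjSubgroup,
      mul_one, ← mul_inv_rev, span_mul_left (conjSubgroup_inv_conjSubgroup g H) _ le_rfl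
      (by rw [conjSubgroup_one])]
    rw [conjSubgroup_inv_conjSubgroup]
  | t_conj g K H hHK =>
    simp only [freeT, freeC, map_mul, FreeAlgebra.lift_ι_apply, genSpan]
    rw [span_conj g⁻¹ (conjSubgroup g H), conjSubgroup_inv_conjSubgroup, mul_one,
      span_mul_left (conjSubgroup_inv_conjSubgroup g H)
      (by rwa [conjSubgroup_inv_conjSubgroup]) le_rfl (by rw [conjSubgroup_one]),
      span_mul_left (conjSubgroup_one K) (by rw [conjSubgroup_inv_conjSubgroup]) hHK
      (by rw [conjSubgroup_one])]
  | r_conj g K H hHK =>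
    simp only [freeR, freeC, map_mul, FreeAlgebra.lift_ι_apply, genSpan]
    rw [span_conj g⁻¹ (conjSubgroup g H), conjSubgroup_inv_conjSubgroup, mul_one,
      span_mul_right (conjSubgroup_inv_conjSubgroup g K)
      (by rw [conjSubgroup_inv_conjSubgroup]) hHK (by rw [conjSubgroup_one]),
      span_mul_left (conjSubgroup_one H) (by rw [conjSubgroup_inv_conjSubgroup]) le_rfl
      (by rwa [conjSubgroup_one])]
  | mackey H L K hLH hKH =>
    have : Finite (DoubleCoset.Quotient (L.subgroupOf H : Set H) (K.subgroupOf H : Set H)) :=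
      Quotient.finite _
    have := Fintype.ofFinite
      (DoubleCoset.Quotient (L.subgroupOf H : Set H) (K.subgroupOf H : Set H))
    rw [finsum_eq_sum_of_fintype, map_sum]
    simp only [freeR, freeC, freeT, map_mul, FreeAlgebra.lift_ι_apply, genSpan]
    rw [span_mul_span_mackey hLH hKH]
    refine Finset.sum_congr rfl fun x _ => ?_
    have hx : L ⊓ conjSubgroup (x.out : G) K =
        conjSubgroup (x.out : G) (conjSubgroup (x.out : G)⁻¹ L ⊓ K) := by
      rw [conjSubgroup_inf, conjSubgroup_conjSubgroup_inv]
    rw [hx, span_tcr inf_le_right (by rw [← hx]; exact inf_le_left),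
      span_conj (x.out : G) (conjSubgroup (x.out : G)⁻¹ L ⊓ K), mul_inv_cancel, mul_one]
  | zero a b hab =>
    rw [map_mul, map_zero, FreeAlgebra.lift_ι_apply, FreeAlgebra.lift_ι_apply]
    exact genSpan_mul_of_ne hab

variable (R G) in
/-- The homomorphism from the Mackey algebra to the algebra of spans. -/
noncomputable def toSpan :
    MackeyAlgebra R G →ₐ[R] BurnsideModule R G (Cosets G × Cosets G) :=
  RingQuot.liftAlgHom R ⟨FreeAlgebra.lift R (genSpan R), fun _ _ h => lift_genSpan_rel h⟩

end

section

variable (R : Type v) [CommRing R] {G : Type u} [Group G]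

/-- The image of a generator in the Mackey algebra. -/
noncomputable def gen (a : MackeyGen G) : MackeyAlgebra R G :=
  RingQuot.mkAlgHom R (MackeyRel R) (FreeAlgebra.ι R a)

open Classical in
/-- `t^K_H` in the Mackey algebra, extended by `0` if `H` is not contained in `K`. -/
noncomputable def T (K H : Subgroup G) : MackeyAlgebra R G :=
  if h : H ≤ K then gen R (.t K H h) else 0

open Classical in
/-- `r^K_H` in the Mackey algebra, extended by `0` if `H` is not contained in `K`. -/
noncomputable def Rs (K H : Subgroup G) : MackeyAlgebra R G :=
  if h : H ≤ K then gen R (.r K H h) else 0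

/-- `c_{g,H}` in the Mackey algebra. -/
noncomputable def C (g : G) (H : Subgroup G) : MackeyAlgebra R G :=
  gen R (.c g H)

variable {R}

theorem T_of_le {K H : Subgroup G} (h : H ≤ K) :
    T R K H = RingQuot.mkAlgHom R (MackeyRel R) (freeT R K H h) := dif_pos h

theorem Rs_of_le {K H : Subgroup G} (h : H ≤ K) :
    Rs R K H = RingQuot.mkAlgHom R (MackeyRel R) (freeR R K H h) := dif_pos h

theorem C_def (g : G) (H : Subgroup G) :
    C R g H = RingQuot.mkAlgHom R (MackeyRel R) (freeC R g H) := rfl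

theorem gen_mul_of_ne {a b : MackeyGen G} (h : a.source ≠ b.target) : gen R a * gen R b = 0 := by
  rw [gen, gen, ← map_mul, RingQuot.mkAlgHom_rel R (MackeyRel.zero a b h), map_zero]

theorem gen_mul_T_of_ne {a : MackeyGen G} {K H : Subgroup G} (h : a.source ≠ K) :
    gen R a * T R K H = 0 := by
  unfold T
  split_ifs with hH
  · exact gen_mul_of_ne h
  · exact mul_zero _

theorem one_eq_finsum [Finite G] : (1 : MackeyAlgebra R G) = ∑ᶠ H : Subgroup G, T R H H := by
  have := Fintype.ofFinite (Subgroup G)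
  have h := RingQuot.mkAlgHom_rel R (MackeyRel.one (R := R) (G := G))
  rw [map_one, finsum_eq_sum_of_fintype, map_sum] at h
  rw [finsum_eq_sum_of_fintype, ← h]
  exact Finset.sum_congr rfl fun H _ => (T_of_le le_rfl).symm

theorem T_self_eq_Rs (H : Subgroup G) : T R H H = Rs R H H := by
  rw [T_of_le le_rfl, Rs_of_le le_rfl]
  exact RingQuot.mkAlgHom_rel R (.t_self_eq_r_self H)

theorem C_of_mem {H : Subgroup G} {h : G} (hh : h ∈ H) : C R h H = T R H H := by
  rw [T_of_le le_rfl]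
  exact (RingQuot.mkAlgHom_rel R (.t_self_eq_c H h hh)).symm

theorem T_mul_T {L K H : Subgroup G} (hKL : K ≤ L) (hHK : H ≤ K) :
    T R L K * T R K H = T R L H := by
  rw [T_of_le hKL, T_of_le hHK, T_of_le (hHK.trans hKL), ← map_mul]
  exact RingQuot.mkAlgHom_rel R (.t_trans L K H hKL hHK)

theorem Rs_mul_Rs {L K H : Subgroup G} (hKL : K ≤ L) (hHK : H ≤ K) :
    Rs R K H * Rs R L K = Rs R L H := by
  rw [Rs_of_le hKL, Rs_of_le hHK, Rs_of_le (hHK.trans hKL), ← map_mul]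
  exact RingQuot.mkAlgHom_rel R (.r_trans L K H hKL hHK)

theorem C_mul_C (g' g : G) (H : Subgroup G) :
    C R g' (conjSubgroup g H) * C R g H = C R (g' * g) H := by
  rw [C_def, C_def, ← map_mul]
  exact RingQuot.mkAlgHom_rel R (.c_mul g' g H)

theorem T_mul_C {K H : Subgroup G} (g : G) (h : H ≤ K) :
    T R (conjSubgroup g K) (conjSubgroup g H) * C R g H = C R g K * T R K H := by
  rw [T_of_le h, T_of_le (conjSubgroup_le_iff.2 h), C_def, C_def, ← map_mul, ← map_mul]
  exact RingQuot.mkAlgHom_rel R (.t_conj g K H h)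

theorem Rs_mul_C {K H : Subgroup G} (g : G) (h : H ≤ K) :
    Rs R (conjSubgroup g K) (conjSubgroup g H) * C R g K = C R g H * Rs R K H := by
  rw [Rs_of_le h, Rs_of_le (conjSubgroup_le_iff.2 h), C_def, C_def, ← map_mul, ← map_mul]
  exact RingQuot.mkAlgHom_rel R (.r_conj g K H h)

theorem Rs_mul_T [Finite G] {H L K : Subgroup G} (hLH : L ≤ H) (hKH : K ≤ H)
    [Fintype (DoubleCoset.Quotient (L.subgroupOf H : Set H) (K.subgroupOf H : Set H))] :
    Rs R H L * T R H K =
      ∑ x : DoubleCoset.Quotient (L.subgroupOf H : Set H) (K.subgroupOf H : Set H),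
        T R L (L ⊓ conjSubgroup (x.out : G) K) *
          C R (x.out : G) (conjSubgroup (x.out : G)⁻¹ L ⊓ K) *
          Rs R K (conjSubgroup (x.out : G)⁻¹ L ⊓ K) := by
  have h := RingQuot.mkAlgHom_rel R (MackeyRel.mackey (R := R) H L K hLH hKH)
  rw [finsum_eq_sum_of_fintype, map_sum, map_mul, ← Rs_of_le, ← T_of_le] at h
  rw [h]
  refine Finset.sum_congr rfl fun x _ => ?_
  rw [map_mul, map_mul, ← Rs_of_le, ← T_of_le, ← C_def]

variable (R) in
/-- The elements `t^H_{ᵍB} c_{g,B} r^K_B` which span the Mackey algebra. -/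
noncomputable def tcr (H K : Subgroup G) (g : G) (B : Subgroup G) : MackeyAlgebra R G :=
  T R H (conjSubgroup g B) * C R g B * Rs R K B

theorem tcr_eq_zero {H K : Subgroup G} {g : G} {B : Subgroup G}
    (h : ¬ (B ≤ K ∧ conjSubgroup g B ≤ H)) : tcr R H K g B = 0 := by
  rw [not_and_or] at h
  unfold tcr
  rcases h with h | h
  · rw [Rs, dif_neg h, mul_zero]
  · rw [T, dif_neg h, zero_mul, zero_mul]

/-- The element `t c r` only depends on the coset of `g` and the conjugacy class of `B`. -/
theorem tcr_shift {H K B : Subgroup G} {g h k : G} (hB : B ≤ K) (hH : conjSubgroup g B ≤ H)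
    (hh : h ∈ H) (hk : k ∈ K) :
    tcr R H K (h * g * k) (conjSubgroup k⁻¹ B) = tcr R H K g B := by
  have h1 : T R H (conjSubgroup h (conjSubgroup g B)) * C R h (conjSubgroup g B) =
      T R H (conjSubgroup g B) := by
    have := T_mul_C (R := R) h hH
    rwa [conjSubgroup_of_mem hh, C_of_mem hh, T_mul_T le_rfl hH] at this
  have h2 : C R k (conjSubgroup k⁻¹ B) * Rs R K (conjSubgroup k⁻¹ B) = Rs R K B := by
    have hB' : conjSubgroup k⁻¹ B ≤ K := by
      rw [← conjSubgroup_of_mem (inv_mem hk), conjSubgroup_le_iff]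
      exact hB
    have := Rs_mul_C (R := R) k hB'
    rw [conjSubgroup_of_mem hk, C_of_mem hk, conjSubgroup_conjSubgroup_inv, T_self_eq_Rs,
      Rs_mul_Rs le_rfl hB] at this
    exact this.symm
  have h3 := C_mul_C (R := R) (h * g) k (conjSubgroup k⁻¹ B)
  have h4 := C_mul_C (R := R) h g B
  rw [conjSubgroup_conjSubgroup_inv, ← h4] at h3
  rw [tcr, tcr, ← h1, ← h2, ← h3, ← conjSubgroup_conjSubgroup, conjSubgroup_conjSubgroup_inv,
    ← conjSubgroup_conjSubgroup]
  simp only [mul_assoc]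

variable (R G) in
/-- The submodule spanned by the elements `t c r`. -/
def tcrSpan : Submodule R (MackeyAlgebra R G) :=
  Submodule.span R {x | ∃ H K g B, x = tcr R H K g B}

theorem tcr_mem (H K : Subgroup G) (g : G) (B : Subgroup G) : tcr R H K g B ∈ tcrSpan R G :=
  Submodule.subset_span ⟨H, K, g, B, rfl⟩

theorem gen_mul_tcr_mem [Finite G] (a : MackeyGen G) (H K : Subgroup G) (g : G) (B : Subgroup G) :
    gen R a * tcr R H K g B ∈ tcrSpan R G := by
  by_cases hs : a.source = H
  swap
  · rw [tcr, ← mul_assoc, ← mul_assoc, gen_mul_T_of_ne hs, zero_mul, zero_mul]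
    exact zero_mem _
  by_cases hB : B ≤ K ∧ conjSubgroup g B ≤ H
  swap
  · rw [tcr_eq_zero hB, mul_zero]
    exact zero_mem _
  obtain ⟨hK, hH⟩ := hB
  subst hs
  cases a with
  | t L H' h =>
    have : gen R (.t L H' h) = T R L H' := (T_of_le h).symm
    rw [this, tcr, ← mul_assoc, ← mul_assoc, MackeyGen.source, T_mul_T h hH]
    exact tcr_mem L K g B
  | c x H' =>
    change C R x H' * _ ∈ _
    rw [tcr, ← mul_assoc, ← mul_assoc, MackeyGen.source, ← T_mul_C (K := H') x hH, mul_assoc (T R _ _),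
      C_mul_C, conjSubgroup_conjSubgroup]
    exact tcr_mem _ K (x * g) B
  | r H' L h =>
    have : Finite (DoubleCoset.Quotient (L.subgroupOf H' : Set H')
      ((conjSubgroup g B).subgroupOf H' : Set H')) := Quotient.finite _
    have := Fintype.ofFinite (DoubleCoset.Quotient (L.subgroupOf H' : Set H')
      ((conjSubgroup g B).subgroupOf H' : Set H'))
    have hr : gen R (.r H' L h) = Rs R H' L := (Rs_of_le h).symm
    rw [hr, tcr, ← mul_assoc, ← mul_assoc, MackeyGen.source, Rs_mul_T h hH, Finset.sum_mul,
      Finset.sum_mul]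
    refine sum_mem fun x _ => ?_
    set y : G := (x.out : G)
    set E := conjSubgroup y⁻¹ L ⊓ conjSubgroup g B with hE
    -- Move `r` past `c_{g,B}`, so that each summand of the Mackey formula is again of the form `t c r`.
    have hE1 : L ⊓ conjSubgroup y (conjSubgroup g B) = conjSubgroup y E := by
      rw [hE, conjSubgroup_inf, conjSubgroup_conjSubgroup_inv]
    obtain ⟨E', hE'⟩ : ∃ E', E = conjSubgroup g E' :=
      ⟨conjSubgroup g⁻¹ E, (conjSubgroup_conjSubgroup_inv g E).symm⟩
    have hEB : E' ≤ B := by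
      rw [← conjSubgroup_le_iff (g := g), ← hE']
      exact inf_le_right
    rw [hE1, hE']
    have : T R L (conjSubgroup y (conjSubgroup g E')) * C R y (conjSubgroup g E') *
        Rs R (conjSubgroup g B) (conjSubgroup g E') * C R g B * Rs R K B =
        tcr R L K (y * g) E' := by
      rw [mul_assoc _ (Rs R _ _), Rs_mul_C g hEB, ← mul_assoc, mul_assoc (T R _ _), C_mul_C,
        mul_assoc, Rs_mul_Rs hK hEB, conjSubgroup_conjSubgroup, tcr]
    rw [this]
    exact tcr_mem _ _ _ _

/-- The elements `t c r` span a left ideal, which contains `1`. -/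
theorem tcrSpan_eq_top [Finite G] : tcrSpan R G = ⊤ := by
  have hmul (a : FreeAlgebra R (MackeyGen G)) : ∀ p ∈ tcrSpan R G,
      RingQuot.mkAlgHom R (MackeyRel R) a * p ∈ tcrSpan R G := by
    induction a using FreeAlgebra.induction with
    | grade0 r =>
      intro p hp
      rw [AlgHom.commutes, ← Algebra.smul_def]
      exact Submodule.smul_mem _ r hp
    | grade1 a =>
      intro p hp
      induction hp using Submodule.span_induction with
      | mem p hp =>
        obtain ⟨H, K, g, B, rfl⟩ := hp
        exact gen_mul_tcr_mem a H K g B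
      | zero => rw [mul_zero]; exact zero_mem _
      | add p q _ _ hp hq => rw [mul_add]; exact add_mem hp hq
      | smul r p _ hp => rw [mul_smul_comm]; exact Submodule.smul_mem _ r hp
    | mul a b ha hb =>
      intro p hp
      rw [map_mul, mul_assoc]
      exact ha _ (hb p hp)
    | add a b ha hb =>
      intro p hp
      rw [map_add, add_mul]
      exact add_mem (ha p hp) (hb p hp)
  have hone : (1 : MackeyAlgebra R G) ∈ tcrSpan R G := by
    have := Fintype.ofFinite (Subgroup G)
    rw [one_eq_finsum, finsum_eq_sum_of_fintype]
    refine sum_mem fun H _ => ?_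
    have : tcr R H H 1 H = T R H H := by
      rw [tcr, conjSubgroup_one, C_of_mem (one_mem H), T_mul_T le_rfl le_rfl, ← T_self_eq_Rs,
        T_mul_T le_rfl le_rfl]
    rw [← this]
    exact tcr_mem _ _ _ _
  rw [eq_top_iff]
  intro a _
  obtain ⟨a, rfl⟩ := RingQuot.mkAlgHom_surjective R (MackeyRel R) a
  rw [← mul_one (RingQuot.mkAlgHom R (MackeyRel R) a)]
  exact hmul a 1 hone

end

section

variable {R : Type v} [CommRing R] {G : Type u} [Group G] [Finite G]

theorem toSpan_gen (a : MackeyGen G) : toSpan R G (gen R a) = genSpan R a := by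
  rw [toSpan, gen, RingQuot.liftAlgHom_mkAlgHom_apply, FreeAlgebra.lift_ι_apply]

theorem toSpan_tcr {H K B : Subgroup G} {g : G} (hK : B ≤ K) (hH : conjSubgroup g B ≤ H) :
    toSpan R G (tcr R H K g B) = span R B (pt H g⁻¹) (pt K 1) := by
  rw [tcr, map_mul, map_mul, T, dif_pos hH, Rs, dif_pos hK, C, toSpan_gen, toSpan_gen, toSpan_gen]
  exact span_tcr hK hH

omit [Finite G] in
theorem exists_pt (z : Cosets G) : pt z.1 z.2.out = z := by
  obtain ⟨H, z⟩ := z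
  exact congrArg (Sigma.mk H) z.out_eq

variable (R) in
/-- The element `t c r` of the Mackey algebra attached to a transitive span `G / A` over a pair of
cosets, for chosen representatives of the cosets. -/
noncomputable def ofPair (p : FixedPair G (Cosets G × Cosets G)) : MackeyAlgebra R G :=
  tcr R p.1.2.1.1 p.1.2.2.1 (p.1.2.1.2.out⁻¹ * p.1.2.2.2.out) (conjSubgroup p.1.2.2.2.out⁻¹ p.1.1)

theorem toSpan_ofPair (p : FixedPair G (Cosets G × Cosets G)) :
    toSpan R G (ofPair R p) = basis R (Quotient.mk (fixedPairSetoid G _) p) := by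
  obtain ⟨⟨A, z, w⟩, h⟩ := p
  have h' := h
  rw [stabilizer_prod, ← exists_pt z, ← exists_pt w, stabilizer_pt, stabilizer_pt] at h'
  obtain ⟨h1, h2⟩ := le_inf_iff.1 h'
  rw [ofPair, toSpan_tcr, span_conj w.2.out]
  · simp only [mul_inv_rev, inv_inv, mul_inv_cancel_left, mul_one, conjSubgroup_conjSubgroup_inv,
      exists_pt]
    rw [span_of_le h, cl_orb]
  · rwa [← conjSubgroup_le_iff (g := w.2.out), conjSubgroup_conjSubgroup_inv]
  · rw [conjSubgroup_conjSubgroup, mul_inv_cancel_right, ← conjSubgroup_le_iff (g := z.2.out),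
      conjSubgroup_conjSubgroup_inv]
    exact h1

omit [Finite G] in
/-- The element attached to a pair does not depend on the choice of representatives. -/
theorem ofPair_eq_tcr {p : FixedPair G (Cosets G × Cosets G)} {H K B : Subgroup G} {g x : G}
    (hB : B ≤ K) (hH : conjSubgroup g B ≤ H)
    (h : p.1 = (conjSubgroup x B, (pt H (x * g⁻¹), pt K x))) : ofPair R p = tcr R H K g B := by
  obtain ⟨p, hp⟩ := p
  subst h
  obtain ⟨a, ha⟩ := QuotientGroup.mk_out_eq_mul H (x * g⁻¹)
  obtain ⟨b, hb⟩ := QuotientGroup.mk_out_eq_mul K x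
  change tcr R H K (((x * g⁻¹ : G) : G ⧸ H).out⁻¹ * ((x : G) : G ⧸ K).out)
    (conjSubgroup ((x : G) : G ⧸ K).out⁻¹ (conjSubgroup x B)) = _
  rw [ha, hb, ← tcr_shift hB hH (inv_mem a.2) b.2, conjSubgroup_conjSubgroup]
  congr 1
  · group
  · congr 1
    group

variable (R G) in
/-- The Mackey algebra is the algebra of spans of finite `G`-sets on the `G`-set of cosets. -/
noncomputable def spanEquiv :
    MackeyAlgebra R G ≃ₐ[R] BurnsideModule R G (Cosets G × Cosets G) :=
  AlgEquiv.ofBijective (toSpan R G) <| by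
    let f : BurnsideModule R G (Cosets G × Cosets G) →ₗ[R] MackeyAlgebra R G :=
      (basis R).constr R fun q => ofPair R q.out
    have hf : f ∘ₗ (toSpan R G).toLinearMap = LinearMap.id := by
      refine LinearMap.ext_on tcrSpan_eq_top ?_
      rintro _ ⟨H, K, g, B, rfl⟩
      by_cases hB : B ≤ K ∧ conjSubgroup g B ≤ H
      swap
      · rw [tcr_eq_zero hB, map_zero, map_zero]
      obtain ⟨hK, hH⟩ := hB
      have h : B ≤ MulAction.stabilizer G (pt H g⁻¹, pt K 1) := by
        rw [stabilizer_prod, stabilizer_pt, stabilizer_pt_one, le_inf_iff,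
          ← conjSubgroup_le_iff (g := g), conjSubgroup_conjSubgroup_inv]
        exact ⟨hH, hK⟩
      rw [LinearMap.comp_apply, AlgHom.toLinearMap_apply, toSpan_tcr hK hH, span_of_le h, cl_orb,
        Module.Basis.constr_basis]
      obtain ⟨x, hx1, hx2⟩ : fixedPairSetoid G (Cosets G × Cosets G) _ _ :=
        Setoid.symm (Quotient.mk_out (s := fixedPairSetoid G (Cosets G × Cosets G))
          ⟨(B, (pt H g⁻¹, pt K 1)), h⟩)
      refine ofPair_eq_tcr hK hH (x := x) (Prod.ext hx1 (hx2.trans ?_))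
      change (pt H (x * g⁻¹), pt K (x * 1)) = _
      rw [mul_one]
    refine ⟨fun a b hab => ?_, ?_⟩
    · have := congrArg f hab
      exact (LinearMap.congr_fun hf a).symm.trans (this.trans (LinearMap.congr_fun hf b))
    · change Function.Surjective (toSpan R G).toLinearMap
      rw [← LinearMap.range_eq_top, eq_top_iff, ← (basis R).span_eq, Submodule.span_le]
      rintro _ ⟨q, rfl⟩
      obtain ⟨p, rfl⟩ := q.exists_rep
      exact ⟨ofPair R p, toSpan_ofPair p⟩

end

end MackeyAlgebra

/-! ### Linear maps out of the Burnside algebra -/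

namespace FinGSet

variable {H : Type u} [Group H]

/-- A function on finite `H`-sets is additive if it is invariant under isomorphisms and turns
disjoint unions into sums. -/
structure IsAdditive {N : Type*} [Add N] (F : FinGSet H → N) : Prop where
  iso : ∀ X Y, Iso X Y → F X = F Y
  sum : ∀ X Y, F (X.sum Y) = F X + F Y

theorem sum_prod_iso (X Y W : FinGSet H) : Iso ((X.sum Y).prod W) ((X.prod W).sum (Y.prod W)) :=
  ⟨Equiv.sumProdDistrib _ _ _, by rintro h ⟨x | y, w⟩ <;> rfl⟩

end FinGSet

section BurnsideLift

variable (R : Type v) [CommRing R] {H : Type u} [Group H]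

theorem burnsideClass_isAdditive : FinGSet.IsAdditive (burnsideClass R (H := H)) where
  iso X Y h := by
    have : GSetClass.mk X = GSetClass.mk Y := Quotient.sound h
    rw [burnsideClass, burnsideClass, this]
  sum X Y := by
    rw [burnsideClass, burnsideClass, burnsideClass, ← map_add, Ideal.Quotient.eq]
    exact Ideal.subset_span ⟨X, Y, rfl⟩

theorem burnsideClass_of_isEmpty (X : FinGSet H) (hX : IsEmpty X.carrier) :
    burnsideClass R X = 0 := by
  have h : (X.sum X).Iso X :=
    ⟨@Equiv.equivOfIsEmpty _ _ (isEmpty_sum.2 ⟨hX, hX⟩) hX,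
      fun _ x => (isEmpty_sum.2 ⟨hX, hX⟩).elim x⟩
  have := (burnsideClass_isAdditive R).iso _ _ h
  rwa [(burnsideClass_isAdditive R).sum, add_eq_left] at this

theorem burnsideClass_mul (X Y : FinGSet H) :
    burnsideClass R X * burnsideClass R Y = burnsideClass R (X.prod Y) := by
  rw [burnsideClass, burnsideClass, ← map_mul, ← map_mul]
  rfl

variable {R} {N : Type*} [AddCommGroup N] [Module R N]

theorem burnside_hom_ext {f f' : BurnsideAlgebra R H →ₗ[R] N}
    (h : ∀ X, f (burnsideClass R X) = f' (burnsideClass R X)) : f = f' := by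
  refine LinearMap.ext fun x => ?_
  obtain ⟨x, rfl⟩ := Ideal.Quotient.mk_surjective x
  induction x using MonoidAlgebra.induction_on with
  | of m =>
    obtain ⟨X, rfl⟩ := m.exists_rep
    exact h X
  | add x y hx hy => rw [map_add, map_add, map_add, hx, hy]
  | smul r x hx =>
    have : Ideal.Quotient.mk (burnsideIdeal R H) (r • x) =
      r • Ideal.Quotient.mk (burnsideIdeal R H) x := rfl
    rw [this, map_smul, map_smul, hx]

/-- The linear map on the free module on isomorphism classes given by an invariant function. -/
noncomputable def freeBurnsideLift {F : FinGSet H → N} (hF : FinGSet.IsAdditive F) :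
    MonoidAlgebra R (GSetClass H) →ₗ[R] N :=
  Finsupp.linearCombination R (Quotient.lift F hF.iso) ∘ₗ
    (MonoidAlgebra.coeffLinearEquiv R).toLinearMap

theorem freeBurnsideLift_of {F : FinGSet H → N} (hF : FinGSet.IsAdditive F) (X : FinGSet H) :
    freeBurnsideLift hF (MonoidAlgebra.of R _ (GSetClass.mk X)) = F X := by
  change Finsupp.linearCombination R (Quotient.lift F hF.iso) (Finsupp.single _ 1) = F X
  exact (Finsupp.linearCombination_single R 1 _).trans (one_smul R (F X))

/-- Since products distribute over disjoint unions, an additive function annihilates the ideal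
generated by the relations `[X ⊔ Y] = [X] + [Y]`. -/
theorem freeBurnsideLift_eq_zero {F : FinGSet H → N} (hF : FinGSet.IsAdditive F)
    {x : MonoidAlgebra R (GSetClass H)} (hx : x ∈ burnsideIdeal R H) :
    freeBurnsideLift hF x = 0 := by
  suffices h : ∀ a, freeBurnsideLift hF (x * a) = 0 by simpa using h 1
  induction hx using Submodule.span_induction with
  | zero => simp
  | add x y _ _ hx hy =>
    intro a
    rw [add_mul, map_add, hx, hy, add_zero]
  | smul b x hx ih =>
    intro a
    rw [smul_eq_mul, mul_assoc, mul_left_comm]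
    exact ih (b * a)
  | mem x hx =>
    intro a
    obtain ⟨X, Y, rfl⟩ := hx
    induction a using MonoidAlgebra.induction_on with
    | of m =>
      obtain ⟨W, rfl⟩ := m.exists_rep
      have key (X : FinGSet H) : freeBurnsideLift hF (MonoidAlgebra.of R _ (GSetClass.mk X) *
          MonoidAlgebra.of R _ (GSetClass.mk W)) = F (X.prod W) := by
        rw [← map_mul]
        exact freeBurnsideLift_of hF (X.prod W)
      change freeBurnsideLift hF (_ * MonoidAlgebra.of R _ (GSetClass.mk W)) = 0
      rw [sub_mul, add_mul, map_sub, map_add, key, key, key,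
        hF.iso _ _ (FinGSet.sum_prod_iso X Y W), hF.sum, sub_self]
    | add a b ha hb => rw [mul_add, map_add, ha, hb, add_zero]
    | smul r a ha => rw [mul_smul_comm, map_smul, ha, smul_zero]

/-- The linear map out of the Burnside algebra given by an additive function. -/
noncomputable def burnsideLift {F : FinGSet H → N} (hF : FinGSet.IsAdditive F) :
    BurnsideAlgebra R H →ₗ[R] N :=
  ((burnsideIdeal R H).restrictScalars R).liftQ (freeBurnsideLift hF)
      (fun _ hx => freeBurnsideLift_eq_zero hF hx) ∘ₗ
    (Submodule.Quotient.restrictScalarsEquiv R (burnsideIdeal R H)).symm.toLinearMap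

theorem burnsideLift_class {F : FinGSet H → N} (hF : FinGSet.IsAdditive F) (X : FinGSet H) :
    burnsideLift hF (burnsideClass R X) = F X :=
  freeBurnsideLift_of hF X

end BurnsideLift

/-! ### Fibres and induction -/

namespace SetOver

variable {G : Type u} [Group G] {Z : Type u} [MulAction G Z]

/-- The fibre of a `G`-set over `Z` at a point fixed by `H`. -/
def fiber (X : SetOver G Z) {H : Subgroup G} {z : Z} (hz : H ≤ MulAction.stabilizer G z) :
    FinGSet H where
  carrier := {x : X.carrier // X.map x = z}
  action := subtypeAction _ fun h x hx => by
    rw [Subgroup.smul_def, X.map_smul, hx]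
    exact hz h.2

theorem fiber_iso {X Y : SetOver G Z} {H : Subgroup G} {z : Z}
    (hz : H ≤ MulAction.stabilizer G z) : Iso X Y → (X.fiber hz).Iso (Y.fiber hz) := by
  rintro ⟨e, he, hm⟩
  exact ⟨e.subtypeEquiv fun x => by rw [hm], fun h x => Subtype.ext (he h x.1)⟩

theorem fiber_sum_iso (X Y : SetOver G Z) {H : Subgroup G} {z : Z}
    (hz : H ≤ MulAction.stabilizer G z) :
    ((X.sum Y).fiber hz).Iso ((X.fiber hz).sum (Y.fiber hz)) := by
  refine ⟨⟨fun p => match p with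
      | ⟨.inl x, h⟩ => .inl ⟨x, h⟩
      | ⟨.inr x, h⟩ => .inr ⟨x, h⟩, fun p => match p with
      | .inl p => ⟨.inl p.1, p.2⟩
      | .inr p => ⟨.inr p.1, p.2⟩, ?_, ?_⟩, ?_⟩
  · rintro ⟨x | x, h⟩ <;> rfl
  · rintro (p | p) <;> rfl
  · rintro g ⟨x | x, h⟩ <;> rfl

variable [Finite G]

/-- The induced `G`-set `G ×_H Y`, over `Z` by `[g, y] ↦ g • z`, where `z` is fixed by `H`. -/
def indOver {H : Subgroup G} (Y : FinGSet H) {z : Z} (hz : H ≤ MulAction.stabilizer G z) :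
    SetOver G Z where
  carrier := (Y.ind (le_top : H ≤ ⊤)).carrier
  action := MulAction.compHom _ (Subgroup.topEquiv (G := G)).symm.toMonoidHom
  finite := (Y.ind (le_top : H ≤ ⊤)).finite
  map := Quotient.lift (fun p : (⊤ : Subgroup G) × Y.carrier => (p.1 : G) • z) (by
    rintro ⟨k, y⟩ _ ⟨h, rfl⟩
    have := hz (inv_mem h.2)
    rw [MulAction.mem_stabilizer_iff] at this
    change (k : G) • z = ((k : G) * (h : G)⁻¹) • z
    rw [mul_smul, this])
  map_smul := by
    rintro g ⟨k, y⟩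
    exact mul_smul g (k : G) z

section indPt

variable {H : Subgroup G} {Y : FinGSet H} {z : Z} {hz : H ≤ MulAction.stabilizer G z}

/-- The element `[1, y]` of the induced `G`-set. -/
def indPt (y : Y.carrier) : (indOver Y hz).carrier :=
  Quotient.mk (FinGSet.indSetoid le_top Y) (1, y)

theorem exists_smul_indPt (p : (indOver Y hz).carrier) : ∃ (g : G) (y : Y.carrier),
    g • indPt y = p := by
  obtain ⟨k, y⟩ := p
  exact ⟨k, y, congrArg (Quotient.mk (FinGSet.indSetoid le_top Y))
    (Prod.ext (mul_one k) rfl)⟩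

theorem smul_indPt_eq_iff {g : G} {y y' : Y.carrier} :
    g • (indPt y : (indOver Y hz).carrier) = indPt y' ↔ ∃ h : H, (h : G) = g ∧ h • y = y' := by
  have h1 : g • (indPt y : (indOver Y hz).carrier) =
      Quotient.mk (FinGSet.indSetoid le_top Y) (⟨g, trivial⟩ * 1, y) := rfl
  rw [h1]
  refine (Quotient.eq (r := FinGSet.indSetoid le_top Y)).trans ?_
  constructor
  · rintro ⟨h, hh⟩
    refine ⟨h, ?_, (congrArg Prod.snd hh).symm⟩
    have := congrArg (fun p : (⊤ : Subgroup G) × Y.carrier => (p.1 : G)) hh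
    simpa [eq_comm, mul_inv_eq_one] using this
  · rintro ⟨h, rfl, rfl⟩
    exact ⟨h, Prod.ext (Subtype.ext (by simp)) rfl⟩

theorem map_indPt (y : Y.carrier) : (indOver Y hz).map (indPt y) = z := one_smul G z

end indPt

/-- A `G`-set generated by a copy of `Y` over `z`, whose translates meet only as they must, is
induced from `Y`. -/
theorem indOver_iso {H : Subgroup G} {Y : FinGSet H} {z : Z} (hz : H ≤ MulAction.stabilizer G z)
    (W : SetOver G Z) (i : Y.carrier → W.carrier) (hi : Function.Injective i)
    (hsmul : ∀ (h : H) y, i (h • y) = (h : G) • i y) (hmap : ∀ y, W.map (i y) = z)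
    (hcover : ∀ w, ∃ (g : G) (y : Y.carrier), g • i y = w)
    (hmem : ∀ (g : G) y y', g • i y = i y' → g ∈ H) : Iso (indOver Y hz) W := by
  let f : (indOver Y hz).carrier → W.carrier :=
    Quotient.lift (fun p : (⊤ : Subgroup G) × Y.carrier => (p.1 : G) • i p.2) (by
      rintro ⟨k, y⟩ _ ⟨h, rfl⟩
      change (k : G) • i y = ((k : G) * (h : G)⁻¹) • i (h • y)
      rw [hsmul, smul_smul, inv_mul_cancel_right])
  have hf (g : G) (p) : f (g • p) = g • f p := by
    obtain ⟨k, y⟩ := p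
    exact mul_smul g (k : G) (i y)
  have hf' (y : Y.carrier) : f (indPt y) = i y := one_smul G (i y)
  refine ⟨Equiv.ofBijective f ⟨?_, ?_⟩, hf, ?_⟩
  · intro p q hpq
    obtain ⟨a, y, rfl⟩ := exists_smul_indPt p
    obtain ⟨b, y', rfl⟩ := exists_smul_indPt q
    rw [hf, hf, hf', hf', ← inv_smul_eq_iff (g := b), smul_smul] at hpq
    rw [← inv_smul_eq_iff (g := b), smul_smul, smul_indPt_eq_iff]
    refine ⟨⟨b⁻¹ * a, hmem _ _ _ hpq⟩, rfl, hi ?_⟩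
    rw [hsmul]
    exact hpq
  · intro w
    obtain ⟨g, y, rfl⟩ := hcover w
    exact ⟨g • indPt y, by rw [hf, hf']⟩
  · intro p
    obtain ⟨a, y, rfl⟩ := exists_smul_indPt p
    change W.map (f (a • indPt y)) = _
    rw [hf, hf', W.map_smul, SetOver.map_smul, hmap, map_indPt]

theorem indOver_iso_of_iso {H : Subgroup G} {Y Y' : FinGSet H} {z : Z}
    (hz : H ≤ MulAction.stabilizer G z) : Y.Iso Y' → Iso (indOver Y hz) (indOver Y' hz) := by
  rintro ⟨e, he⟩
  refine indOver_iso hz _ (fun y => indPt (e y)) (fun y y' h => ?_) (fun h y => ?_)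
    (fun y => map_indPt _) (fun w => ?_) (fun g y y' h => ?_)
  · obtain ⟨h, h1, h2⟩ := smul_indPt_eq_iff.1 ((one_smul G _).trans h)
    obtain rfl : h = 1 := Subtype.ext h1
    rwa [one_smul, e.apply_eq_iff_eq] at h2
  · exact (smul_indPt_eq_iff.2 ⟨h, rfl, (he h y).symm⟩).symm
  · obtain ⟨g, y, rfl⟩ := exists_smul_indPt w
    exact ⟨g, e.symm y, by rw [e.apply_symm_apply]⟩
  · obtain ⟨a, rfl, -⟩ := smul_indPt_eq_iff.1 h
    exact a.2

theorem indOver_sum_iso {H : Subgroup G} (Y Y' : FinGSet H) {z : Z}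
    (hz : H ≤ MulAction.stabilizer G z) :
    Iso (indOver (Y.sum Y') hz) ((indOver Y hz).sum (indOver Y' hz)) := by
  refine indOver_iso hz _ (Sum.map indPt indPt) ?_ ?_ ?_ ?_ ?_
  · have hinj (Y : FinGSet H) : Function.Injective (indPt : Y.carrier → (indOver Y hz).carrier) := by
      intro y y' h
      obtain ⟨h, h1, h2⟩ := smul_indPt_eq_iff.1 ((one_smul G _).trans h)
      obtain rfl : h = 1 := Subtype.ext h1
      rwa [one_smul] at h2
    exact (hinj Y).sumMap (hinj Y')
  · rintro h (y | y)
    · exact congrArg Sum.inl (smul_indPt_eq_iff.2 ⟨h, rfl, rfl⟩).symm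
    · exact congrArg Sum.inr (smul_indPt_eq_iff.2 ⟨h, rfl, rfl⟩).symm
  · rintro (y | y) <;> exact map_indPt (hz := hz) y
  · rintro (w | w) <;> obtain ⟨g, y, rfl⟩ := exists_smul_indPt w
    · exact ⟨g, Sum.inl y, rfl⟩
    · exact ⟨g, Sum.inr y, rfl⟩
  · rintro g (y | y) (y' | y') h
    · obtain ⟨a, rfl, -⟩ := smul_indPt_eq_iff.1 (Sum.inl_injective h)
      exact a.2
    · cases h
    · cases h
    · obtain ⟨a, rfl, -⟩ := smul_indPt_eq_iff.1 (Sum.inr_injective h)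
      exact a.2

/-- A `G`-set lying over the orbit of `z` is induced from its fibre at `z`. -/
theorem indOver_fiber_iso (X : SetOver G Z) {z : Z} {H : Subgroup G}
    (hz : MulAction.stabilizer G z = H) (hX : ∀ x, ∃ g : G, g • z = X.map x) :
    Iso (indOver (X.fiber hz.ge) hz.ge) X := by
  refine indOver_iso hz.ge X Subtype.val Subtype.val_injective (fun _ _ => rfl) (fun y => y.2)
    (fun w => ?_) (fun g y y' h => ?_)
  · obtain ⟨g, hg⟩ := hX w
    exact ⟨g, ⟨g⁻¹ • w, by rw [X.map_smul, ← hg, inv_smul_smul]⟩, smul_inv_smul g w⟩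
  · have := congrArg X.map h
    rw [X.map_smul, y.2, y'.2] at this
    rw [← hz]
    exact this

/-- An `H`-set is the fibre at `z` of the induced `G`-set, if `H` is the stabilizer of `z`. -/
theorem fiber_indOver_iso {z : Z} {H : Subgroup G} (hz : MulAction.stabilizer G z = H)
    (Y : FinGSet H) : ((indOver Y hz.ge).fiber hz.ge).Iso Y := by
  refine FinGSet.iso_equivalence.symm ⟨Equiv.ofBijective
    (fun y => ⟨indPt y, map_indPt y⟩) ⟨fun y y' h => ?_, fun p => ?_⟩, fun h y => Subtype.ext ?_⟩
  · obtain ⟨h, h1, h2⟩ := smul_indPt_eq_iff.1 ((one_smul G _).trans (congrArg Subtype.val h))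
    obtain rfl : h = 1 := Subtype.ext h1
    rwa [one_smul] at h2
  · obtain ⟨p, hp⟩ := p
    obtain ⟨g, y, rfl⟩ := exists_smul_indPt p
    rw [SetOver.map_smul, map_indPt] at hp
    have hg : g ∈ H := hz ▸ hp
    exact ⟨(⟨g, hg⟩ : H) • y, Subtype.ext (smul_indPt_eq_iff.2 ⟨⟨g, hg⟩, rfl, rfl⟩).symm⟩
  · exact (smul_indPt_eq_iff.2 ⟨h, rfl, rfl⟩).symm

/-- The underlying `G`-set, as a set with an action of the subgroup `⊤`. -/
def toTop (X : SetOver G Z) : FinGSet (⊤ : Subgroup G) where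
  carrier := X.carrier

omit [Finite G] in
theorem toTop_iso {X Y : SetOver G Z} : Iso X Y → X.toTop.Iso Y.toTop := by
  rintro ⟨e, he, -⟩
  exact ⟨e, fun g x => he g x⟩

theorem toTop_indOver_iso {H : Subgroup G} (Y : FinGSet H) {z : Z}
    (hz : H ≤ MulAction.stabilizer G z) :
    (indOver Y hz).toTop.Iso (Y.ind (le_top : H ≤ ⊤)) :=
  ⟨Equiv.refl _, fun _ _ => rfl⟩

end SetOver

namespace BurnsideModule

open SetOver

variable (R : Type v) [CommRing R] {G : Type u} [Group G] [Finite G] {Z : Type u} [MulAction G Z]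
  {z : Z} {H : Subgroup G}

omit [Finite G] in
theorem fiber_isAdditive (hz : H ≤ MulAction.stabilizer G z) :
    IsAdditive fun X : SetOver G Z => burnsideClass R (X.fiber hz) where
  iso _ _ h := (burnsideClass_isAdditive R).iso _ _ (fiber_iso hz h)
  sum X Y := by
    rw [(burnsideClass_isAdditive R).iso _ _ (fiber_sum_iso X Y hz),
      (burnsideClass_isAdditive R).sum]

/-- The fibre map `RB(Z) → RB(H)` at a point fixed by `H`. -/
noncomputable def fiberHom (hz : H ≤ MulAction.stabilizer G z) :
    BurnsideModule R G Z →ₗ[R] BurnsideAlgebra R H :=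
  lift R fun X => burnsideClass R (X.fiber hz)

theorem fiberHom_cl (hz : H ≤ MulAction.stabilizer G z) (X : SetOver G Z) :
    fiberHom R hz (cl R X) = burnsideClass R (X.fiber hz) :=
  lift_cl (fiber_isAdditive R hz) X

theorem indOver_isAdditive (hz : H ≤ MulAction.stabilizer G z) :
    FinGSet.IsAdditive fun Y : FinGSet H => cl R (indOver Y hz) where
  iso _ _ h := (cl_isAdditive R).iso _ _ (indOver_iso_of_iso hz h)
  sum Y Y' := by
    rw [(cl_isAdditive R).iso _ _ (indOver_sum_iso Y Y' hz), (cl_isAdditive R).sum]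

/-- Induction `RB(H) → RB(Z)` at a point fixed by `H`. -/
noncomputable def indHom (hz : H ≤ MulAction.stabilizer G z) :
    BurnsideAlgebra R H →ₗ[R] BurnsideModule R G Z :=
  burnsideLift (indOver_isAdditive R hz)

theorem indHom_class (hz : H ≤ MulAction.stabilizer G z) (Y : FinGSet H) :
    indHom R hz (burnsideClass R Y) = cl R (indOver Y hz) :=
  burnsideLift_class _ Y

theorem fiberHom_indHom (hz : MulAction.stabilizer G z = H) (y : BurnsideAlgebra R H) :
    fiberHom R hz.ge (indHom R hz.ge y) = y := by
  suffices h : fiberHom R hz.ge ∘ₗ indHom R hz.ge = LinearMap.id from LinearMap.congr_fun h y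
  refine burnside_hom_ext fun Y => ?_
  rw [LinearMap.comp_apply, indHom_class, fiberHom_cl]
  exact (burnsideClass_isAdditive R).iso _ _ (fiber_indOver_iso hz Y)

theorem indHom_fiberHom_cl (hz : MulAction.stabilizer G z = H) (X : SetOver G Z)
    (hX : ∀ x, ∃ g : G, g • z = X.map x) :
    indHom R hz.ge (fiberHom R hz.ge (cl R X)) = cl R X := by
  rw [fiberHom_cl, indHom_class]
  exact (cl_isAdditive R).iso _ _ (indOver_fiber_iso X hz hX)

theorem fiberHom_cl_eq_zero (hz : H ≤ MulAction.stabilizer G z) (X : SetOver G Z)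
    (hX : ∀ x, X.map x ≠ z) : fiberHom R hz (cl R X) = 0 := by
  rw [fiberHom_cl]
  exact burnsideClass_of_isEmpty R _ ⟨fun x => hX x.1 x.2⟩

end BurnsideModule

/-! ### From a stable family of forms to a symmetrizing form -/

theorem IsSymmAlgebra.of_algEquiv {R A B : Type*} [CommRing R] [Ring A] [Algebra R A] [Ring B]
    [Algebra R B] (e : A ≃ₐ[R] B) (h : IsSymmAlgebra R A) : IsSymmAlgebra R B := by
  obtain ⟨h1, h2, b, hassoc, hsymm, hb⟩ := h
  refine ⟨Module.Finite.equiv e.toLinearEquiv, Module.Projective.of_equiv e.toLinearEquiv,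
    (e.symm.toLinearEquiv.dualMap.toLinearMap ∘ₗ b) ∘ₗ e.symm.toLinearEquiv.toLinearMap,
    fun x y z => ?_, fun x y => hsymm _ _, ?_⟩
  · change b (e.symm (x * y)) (e.symm z) = b (e.symm x) (e.symm (y * z))
    rw [map_mul e.symm, map_mul e.symm, hassoc]
  · exact (e.symm.toLinearEquiv.dualMap.bijective.comp hb).comp e.symm.bijective

/-- An orthogonal sum of non-degenerate forms is non-degenerate. -/
theorem bijective_of_orthogonal {R A I : Type*} [CommRing R] [AddCommGroup A] [Module R A]
    [Fintype I] {M : I → Type*} [∀ i, AddCommGroup (M i)] [∀ i, Module R (M i)]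
    (b : A →ₗ[R] Module.Dual R A) (e f : A ≃ₗ[R] ∀ i, M i) (β : ∀ i, M i →ₗ[R] Module.Dual R (M i))
    (hβ : ∀ i, Function.Bijective (β i)) (h : ∀ x y, b x y = ∑ i, β i (e x i) (f y i)) :
    Function.Bijective b := by
  classical
  let g : A ≃ₗ[R] Module.Dual R A :=
    e ≪≫ₗ (LinearEquiv.piCongrRight fun i => LinearEquiv.ofBijective (β i) (hβ i)) ≪≫ₗ
      LinearMap.lsum R M R ≪≫ₗ f.dualMap
  have : ⇑b = ⇑g := by
    funext x
    refine LinearMap.ext fun y => ?_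
    rw [h]
    simp [g, LinearMap.lsum_apply]
  rw [this]
  exact g.bijective

namespace SetOver

variable {G : Type u} [Group G] {Z : Type u} [MulAction G Z]

/-- The fibre product over `Z`. -/
def prodOver (X Y : SetOver G Z) : SetOver G Z where
  carrier := {p : X.carrier × Y.carrier // X.map p.1 = Y.map p.2}
  action := subtypeAction _ fun g p h => by
    rw [Prod.smul_fst, Prod.smul_snd, X.map_smul, Y.map_smul, h]
  map p := X.map p.1.1
  map_smul g p := X.map_smul g p.1.1

theorem fiber_prodOver_iso (X Y : SetOver G Z) {H : Subgroup G} {z : Z}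
    (hz : H ≤ MulAction.stabilizer G z) :
    ((X.prodOver Y).fiber hz).Iso ((X.fiber hz).prod (Y.fiber hz)) :=
  ⟨⟨fun p => (⟨p.1.1.1, p.2⟩, ⟨p.1.1.2, p.1.2.symm.trans p.2⟩),
    fun p => ⟨⟨(p.1.1, p.2.1), p.1.2.trans p.2.2.symm⟩, p.1.2⟩, fun _ => rfl, fun _ => rfl⟩,
    fun _ _ => rfl⟩

/-- The span with exchanged legs. -/
def swap (X : SetOver G (Z × Z)) : SetOver G (Z × Z) where
  carrier := X.carrier
  map x := (X.map x).swap
  map_smul g x := congrArg Prod.swap (X.map_smul g x)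

/-- The trace of a span: the points at which its legs agree. -/
def trace (X : SetOver G (Z × Z)) : FinGSet (⊤ : Subgroup G) :=
  (X.restrict (fun x => (X.map x).1 = (X.map x).2) fun g x h => by
    rw [X.map_smul, Prod.smul_fst, Prod.smul_snd, h]).toTop

theorem trace_iso {X Y : SetOver G (Z × Z)} : Iso X Y → X.trace.Iso Y.trace := by
  rintro ⟨e, he, hm⟩
  exact ⟨e.subtypeEquiv fun x => by rw [hm], fun h x => Subtype.ext (he h x.1)⟩

theorem trace_sum_iso (X Y : SetOver G (Z × Z)) :
    (X.sum Y).trace.Iso (X.trace.sum Y.trace) := by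
  refine ⟨⟨fun p => match p with
      | ⟨.inl x, h⟩ => .inl ⟨x, h⟩
      | ⟨.inr x, h⟩ => .inr ⟨x, h⟩, fun p => match p with
      | .inl p => ⟨.inl p.1, p.2⟩
      | .inr p => ⟨.inr p.1, p.2⟩, ?_, ?_⟩, ?_⟩
  · rintro ⟨x | x, h⟩ <;> rfl
  · rintro (p | p) <;> rfl
  · rintro g ⟨x | x, h⟩ <;> rfl

theorem trace_comp_iso_comm (X Y : SetOver G (Z × Z)) :
    (X.comp Y).trace.Iso (Y.comp X).trace :=
  ⟨⟨fun p => ⟨⟨(p.1.1.2, p.1.1.1), p.2.symm⟩, p.1.2.symm⟩,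
    fun p => ⟨⟨(p.1.1.2, p.1.1.1), p.2.symm⟩, p.1.2.symm⟩, fun _ => rfl, fun _ => rfl⟩,
    fun _ _ => rfl⟩

theorem trace_comp_iso (X Y : SetOver G (Z × Z)) :
    (X.comp Y).trace.Iso (X.prodOver Y.swap).toTop :=
  ⟨⟨fun p => ⟨(p.1.1.1, p.1.1.2), Prod.ext p.2 p.1.2⟩,
    fun p => ⟨⟨(p.1.1, p.1.2), (Prod.ext_iff.1 p.2).2⟩, (Prod.ext_iff.1 p.2).1⟩,
    fun _ => rfl, fun _ => rfl⟩, fun _ _ => rfl⟩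

end SetOver

namespace BurnsideModule

open SetOver

variable (R : Type v) [CommRing R] {G : Type u} [Group G] [Finite G] {Z : Type u} [MulAction G Z]

omit [Finite G] in
theorem toTop_isAdditive : IsAdditive fun X : SetOver G Z => burnsideClass R X.toTop where
  iso _ _ h := (burnsideClass_isAdditive R).iso _ _ (toTop_iso h)
  sum X Y := (burnsideClass_isAdditive R).sum X.toTop Y.toTop

omit [Finite G] in
theorem trace_isAdditive : IsAdditive fun X : SetOver G (Z × Z) => burnsideClass R X.trace where
  iso _ _ h := (burnsideClass_isAdditive R).iso _ _ (trace_iso h)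
  sum X Y := by
    rw [(burnsideClass_isAdditive R).iso _ _ (trace_sum_iso X Y),
      (burnsideClass_isAdditive R).sum]

omit [Finite G] in
theorem swap_isAdditive : IsAdditive fun X : SetOver G (Z × Z) => cl R X.swap where
  iso X Y := by
    rintro ⟨e, he, hm⟩
    exact (cl_isAdditive R).iso _ _ ⟨e, he, fun x => congrArg Prod.swap (hm x)⟩
  sum X Y := by
    rw [← (cl_isAdditive R).sum]
    exact (cl_isAdditive R).iso _ _ ⟨Equiv.refl _, fun _ _ => rfl, by rintro (x | x) <;> rfl⟩

/-- Forgetting the map to `Z`. -/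
noncomputable def toTopHom : BurnsideModule R G Z →ₗ[R] BurnsideAlgebra R (⊤ : Subgroup G) :=
  lift R fun X => burnsideClass R X.toTop

/-- The trace `RB(Z × Z) → RB(G)`. -/
noncomputable def traceHom :
    BurnsideModule R G (Z × Z) →ₗ[R] BurnsideAlgebra R (⊤ : Subgroup G) :=
  lift R fun X => burnsideClass R X.trace

/-- Exchanging the legs of spans. -/
noncomputable def swapHom : BurnsideModule R G (Z × Z) →ₗ[R] BurnsideModule R G (Z × Z) :=
  lift R fun X => cl R X.swap

variable {R} in
theorem toTopHom_cl (X : SetOver G Z) : toTopHom R (cl R X) = burnsideClass R X.toTop :=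
  lift_cl (toTop_isAdditive R) X

variable {R} in
theorem traceHom_cl (X : SetOver G (Z × Z)) : traceHom R (cl R X) = burnsideClass R X.trace :=
  lift_cl (trace_isAdditive R) X

variable {R} in
theorem swapHom_cl (X : SetOver G (Z × Z)) : swapHom R (cl R X) = cl R X.swap :=
  lift_cl (swap_isAdditive R) X

theorem swapHom_swapHom (s : BurnsideModule R G (Z × Z)) : swapHom R (swapHom R s) = s := by
  suffices h : swapHom R ∘ₗ swapHom R = LinearMap.id by
    rw [← LinearMap.comp_apply, h, LinearMap.id_apply]
  refine hom_ext fun A z hA => ?_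
  rw [LinearMap.comp_apply, swapHom_cl, swapHom_cl, LinearMap.id_apply]
  exact (cl_isAdditive R).iso _ _ ⟨Equiv.refl _, fun _ _ => rfl, fun _ => rfl⟩

/-- The map of `RB(Z)` to the product of the Burnside algebras of the stabilizers, one for each
orbit of `Z`. -/
noncomputable def fibersHom : BurnsideModule R G Z →ₗ[R]
    ∀ o : MulAction.orbitRel.Quotient G Z, BurnsideAlgebra R (MulAction.stabilizer G o.out) :=
  LinearMap.pi fun _ => fiberHom R le_rfl

/-- The fibres of a transitive `G`-set over `Z` are empty outside the orbit that it maps to. -/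
theorem fiberHom_orb_of_ne {A : Subgroup G} {z : Z} {hA : A ≤ MulAction.stabilizer G z}
    {o : MulAction.orbitRel.Quotient G Z} (ho : o ≠ Quotient.mk _ z) :
    fiberHom R (le_refl (MulAction.stabilizer G o.out)) (cl R (orb A z hA)) = 0 := by
  refine fiberHom_cl_eq_zero R _ _ fun x hx => ho ?_
  obtain ⟨g, rfl⟩ := exists_smul_orbPt x
  rw [SetOver.map_smul, map_orbPt] at hx
  rw [← o.out_eq, ← hx]
  exact Quotient.sound (MulAction.orbitRel_apply.2 ⟨g, rfl⟩)

theorem exists_smul_out {A : Subgroup G} {z : Z} {hA : A ≤ MulAction.stabilizer G z}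
    (x : (orb A z hA).carrier) :
    ∃ g : G, g • (Quotient.mk _ z : MulAction.orbitRel.Quotient G Z).out = (orb A z hA).map x := by
  obtain ⟨g, rfl⟩ := exists_smul_orbPt x
  obtain ⟨a, ha⟩ := MulAction.orbitRel_apply.1
    (Quotient.mk_out (s := MulAction.orbitRel G Z) z)
  refine ⟨g * a⁻¹, ?_⟩
  rw [SetOver.map_smul, map_orbPt, mul_smul, smul_left_cancel_iff, inv_smul_eq_iff]
  exact ha.symm

theorem sum_indHom_fiberHom [Fintype (MulAction.orbitRel.Quotient G Z)]
    (s : BurnsideModule R G Z) :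
    ∑ o : MulAction.orbitRel.Quotient G Z,
      indHom R (le_refl (MulAction.stabilizer G o.out)) (fiberHom R le_rfl s) = s := by
  suffices h : ∑ o : MulAction.orbitRel.Quotient G Z,
      indHom R (le_refl (MulAction.stabilizer G o.out)) ∘ₗ fiberHom R le_rfl = LinearMap.id by
    simpa [LinearMap.sum_apply] using LinearMap.congr_fun h s
  refine hom_ext fun A z hA => ?_
  rw [LinearMap.sum_apply, Finset.sum_eq_single (Quotient.mk _ z)]
  · exact indHom_fiberHom_cl R rfl _ exists_smul_out
  · intro o _ ho
    rw [LinearMap.comp_apply, fiberHom_orb_of_ne R ho, map_zero]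
  · exact fun h => absurd (Finset.mem_univ _) h

theorem fiberHom_indHom_of_ne {o o' : MulAction.orbitRel.Quotient G Z} (h : o ≠ o')
    (y : BurnsideAlgebra R (MulAction.stabilizer G o'.out)) :
    fiberHom R (le_refl (MulAction.stabilizer G o.out)) (indHom R le_rfl y) = 0 := by
  suffices h : fiberHom R (le_refl (MulAction.stabilizer G o.out)) ∘ₗ
      indHom R (le_refl (MulAction.stabilizer G o'.out)) = 0 from LinearMap.congr_fun h y
  refine burnside_hom_ext fun Y => ?_
  rw [LinearMap.comp_apply, indHom_class, fiberHom_cl_eq_zero, LinearMap.zero_apply]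
  intro x hx
  obtain ⟨g, y, rfl⟩ := exists_smul_indPt x
  rw [SetOver.map_smul, map_indPt] at hx
  rw [← o.out_eq, ← o'.out_eq, ← hx] at h
  exact h (Quotient.sound (MulAction.orbitRel_apply.2 ⟨g, rfl⟩))

theorem fibersHom_bijective [Finite Z] :
    Function.Bijective (fibersHom R : BurnsideModule R G Z →ₗ[R] _) := by
  classical
  have : Finite (MulAction.orbitRel.Quotient G Z) := Quotient.finite _
  have := Fintype.ofFinite (MulAction.orbitRel.Quotient G Z)
  refine Function.bijective_iff_has_inverse.2
    ⟨fun y => ∑ o, indHom R le_rfl (y o), sum_indHom_fiberHom R, fun y => funext fun o => ?_⟩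
  change fiberHom R le_rfl (∑ o, indHom R le_rfl (y o)) = y o
  rw [map_sum, Finset.sum_eq_single o]
  · exact fiberHom_indHom R rfl (y o)
  · exact fun o' _ ho' => fiberHom_indHom_of_ne R ho'.symm _
  · exact fun h => absurd (Finset.mem_univ _) h

variable {R}

/-- For a stable family, the value at a `G`-set over `Z` is the sum over the orbits of `Z` of the
values at the fibres. -/
theorem apply_toTopHom [Fintype (MulAction.orbitRel.Quotient G Z)]
    {φ : ∀ H : Subgroup G, Module.Dual R (BurnsideAlgebra R H)} (hφ : IsStableByInduction R φ)
    (s : BurnsideModule R G Z) :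
    φ ⊤ (toTopHom R s) = ∑ o : MulAction.orbitRel.Quotient G Z,
      φ (MulAction.stabilizer G o.out) (fiberHom R le_rfl s) := by
  have key {H : Subgroup G} {z : Z} (hz : H ≤ MulAction.stabilizer G z)
      (y : BurnsideAlgebra R H) : φ ⊤ (toTopHom R (indHom R hz y)) = φ H y := by
    suffices h : φ ⊤ ∘ₗ toTopHom R ∘ₗ indHom R hz = φ H from LinearMap.congr_fun h y
    refine burnside_hom_ext fun Y => ?_
    rw [LinearMap.comp_apply, LinearMap.comp_apply, indHom_class, toTopHom_cl, ← hφ H Y,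
      (burnsideClass_isAdditive R).iso _ _ (toTop_indOver_iso Y hz)]
  conv_lhs => rw [← sum_indHom_fiberHom R s, map_sum, map_sum]
  exact Finset.sum_congr rfl fun o _ => key _ _

variable [Finite Z]

theorem apply_traceHom_mul [Fintype (MulAction.orbitRel.Quotient G (Z × Z))]
    {φ : ∀ H : Subgroup G, Module.Dual R (BurnsideAlgebra R H)} (hφ : IsStableByInduction R φ)
    (s t : BurnsideModule R G (Z × Z)) :
    φ ⊤ (traceHom R (s * t)) = ∑ o : MulAction.orbitRel.Quotient G (Z × Z),
      mulForm (φ (MulAction.stabilizer G o.out)) (fibersHom R s o)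
        (fibersHom R (swapHom R t) o) := by
  let b : BurnsideModule R G (Z × Z) →ₗ[R] Module.Dual R (BurnsideModule R G (Z × Z)) :=
    ∑ o : MulAction.orbitRel.Quotient G (Z × Z),
      (mulForm (φ (MulAction.stabilizer G o.out))).compl₁₂ (fiberHom R le_rfl)
        (fiberHom R le_rfl ∘ₗ swapHom R)
  suffices h : (LinearMap.mul R (BurnsideModule R G (Z × Z))).compr₂ (φ ⊤ ∘ₗ traceHom R) = b by
    have := LinearMap.congr_fun (LinearMap.congr_fun h s) t
    simpa [b, LinearMap.sum_apply, fibersHom] using this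
  refine hom_ext fun A z hA => hom_ext fun A' z' hA' => ?_
  set X := orb A z hA
  set Y := orb A' z' hA'
  have h1 : (LinearMap.mul R (BurnsideModule R G (Z × Z))).compr₂ (φ ⊤ ∘ₗ traceHom R)
      (cl R X) (cl R Y) = φ ⊤ (toTopHom R (cl R (X.prodOver Y.swap))) := by
    rw [LinearMap.compr₂_apply, LinearMap.mul_apply', LinearMap.comp_apply, cl_mul_cl, traceHom_cl,
      toTopHom_cl,
      (burnsideClass_isAdditive R).iso _ _ (trace_comp_iso X Y)]
  rw [h1, apply_toTopHom hφ]
  simp only [b, LinearMap.sum_apply]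
  refine Finset.sum_congr rfl fun o _ => ?_
  change _ = φ _ (fiberHom R le_rfl (cl R X) * fiberHom R le_rfl (swapHom R (cl R Y)))
  rw [swapHom_cl, fiberHom_cl, fiberHom_cl, fiberHom_cl,
    burnsideClass_mul, (burnsideClass_isAdditive R).iso _ _ (fiber_prodOver_iso X Y.swap _)]

theorem traceHom_mul_comm (s t : BurnsideModule R G (Z × Z)) :
    traceHom R (s * t) = traceHom R (t * s) := by
  suffices h : (LinearMap.mul R (BurnsideModule R G (Z × Z))).compr₂ (traceHom R) =
      (LinearMap.mul R (BurnsideModule R G (Z × Z))).flip.compr₂ (traceHom R) from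
    LinearMap.congr_fun (LinearMap.congr_fun h s) t
  refine hom_ext fun A z hA => hom_ext fun A' z' hA' => ?_
  rw [LinearMap.compr₂_apply, LinearMap.mul_apply', LinearMap.compr₂_apply, LinearMap.flip_apply,
    LinearMap.mul_apply', cl_mul_cl, cl_mul_cl, traceHom_cl, traceHom_cl]
  exact (burnsideClass_isAdditive R).iso _ _ (trace_comp_iso_comm _ _)

/-- A stable family of non-degenerate forms makes the algebra of spans symmetric. -/
theorem isSymmAlgebra_of_stable (h : BurnsideStableSymmetric R G) :
    IsSymmAlgebra R (BurnsideModule R G (Z × Z)) := by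
  obtain ⟨φ, hφ, hb⟩ := h
  have : Finite (MulAction.orbitRel.Quotient G (Z × Z)) := Quotient.finite _
  have := Fintype.ofFinite (MulAction.orbitRel.Quotient G (Z × Z))
  let e := LinearEquiv.ofBijective (fibersHom R : BurnsideModule R G (Z × Z) →ₗ[R] _)
    (fibersHom_bijective R)
  let w : BurnsideModule R G (Z × Z) ≃ₗ[R] BurnsideModule R G (Z × Z) :=
    LinearEquiv.ofInvolutive (swapHom R) (swapHom_swapHom R)
  refine ⟨inferInstance, inferInstance, mulForm (φ ⊤ ∘ₗ traceHom R), fun x y z => ?_, fun x y => ?_,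
    bijective_of_orthogonal _ e (w ≪≫ₗ e) _ (fun o => hb _) (apply_traceHom_mul hφ)⟩
  · change φ ⊤ (traceHom R (x * y * z)) = φ ⊤ (traceHom R (x * (y * z)))
    rw [mul_assoc]
  · change φ ⊤ (traceHom R (x * y)) = φ ⊤ (traceHom R (y * x))
    rw [traceHom_mul_comm]

end BurnsideModule

/-! ### From a symmetrizing form to a stable family of forms -/

namespace BurnsideModule

open SetOver Cosets

section Corner

variable (R : Type v) [CommRing R] {G : Type u} [Group G] [Finite G]

/-- The idempotent of the algebra of spans given by the identity span of `G/H`. -/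
noncomputable def idem (H : Subgroup G) : BurnsideModule R G (Cosets G × Cosets G) :=
  span R H (pt H 1) (pt H 1)

variable {R}

theorem idem_eq (H : Subgroup G) (g : G) :
    idem R H = span R (conjSubgroup g H) (pt H g) (pt H g) := by
  have := span_smul (R := R) g H (pt H 1) (pt H 1)
  rw [smul_pt, mul_one] at this
  exact this.symm

theorem idem_mul_span {A : Subgroup G} {u w : Cosets G}
    (h : A ≤ MulAction.stabilizer G (u, w)) : idem R u.1 * span R A u w = span R A u w := by
  rw [stabilizer_prod, le_inf_iff] at h
  have hu : pt u.1 u.2.out = u := MackeyAlgebra.exists_pt u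
  rw [idem_eq u.1 u.2.out, hu]
  have hs : MulAction.stabilizer G u = conjSubgroup u.2.out u.1 := by
    conv_lhs => rw [← hu, stabilizer_pt]
  exact span_mul_span_left hs.ge hs (hs ▸ h.1) h.2

theorem span_mul_idem {A : Subgroup G} {u w : Cosets G}
    (h : A ≤ MulAction.stabilizer G (u, w)) : span R A u w * idem R w.1 = span R A u w := by
  rw [stabilizer_prod, le_inf_iff] at h
  have hw : pt w.1 w.2.out = w := MackeyAlgebra.exists_pt w
  rw [idem_eq w.1 w.2.out, hw]
  have hs : MulAction.stabilizer G w = conjSubgroup w.2.out w.1 := by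
    conv_lhs => rw [← hw, stabilizer_pt]
  exact span_mul_span_right h.1 hs (hs ▸ h.2) hs.ge

theorem idem_mul_span_of_ne {H A : Subgroup G} {u w : Cosets G} (h : H ≠ u.1) :
    idem R H * span R A u w = 0 :=
  span_mul_span_of_ne _ _ h

theorem span_mul_idem_of_ne {H A : Subgroup G} {u w : Cosets G} (h : w.1 ≠ H) :
    span R A u w * idem R H = 0 :=
  span_mul_span_of_ne _ _ h

/-- If the orbit of `z` is a full block of pairs of cosets, then taking the fibre at `z` and
inducing it is the projection to the corresponding corner of the algebra of spans. -/
theorem indHom_fiberHom {z : Cosets G × Cosets G} {H : Subgroup G}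
    (hz : MulAction.stabilizer G z = H)
    (horb : ∀ u w : Cosets G, u.1 = z.1.1 → w.1 = z.2.1 → ∃ g : G, g • z = (u, w))
    (s : BurnsideModule R G (Cosets G × Cosets G)) :
    indHom R hz.ge (fiberHom R hz.ge s) = idem R z.1.1 * s * idem R z.2.1 := by
  suffices h : indHom R hz.ge ∘ₗ fiberHom R hz.ge =
      LinearMap.mulLeftRight R (idem R z.1.1, idem R z.2.1) from LinearMap.congr_fun h s
  refine hom_ext fun A z' hA => ?_
  obtain ⟨u, w⟩ := z'
  rw [LinearMap.comp_apply, LinearMap.mulLeftRight_apply]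
  by_cases h : u.1 = z.1.1 ∧ w.1 = z.2.1
  · rw [indHom_fiberHom_cl R hz, ← h.1, ← h.2, ← span_of_le hA, idem_mul_span hA, span_mul_idem hA]
    intro x
    obtain ⟨g, rfl⟩ := exists_smul_orbPt x
    rw [SetOver.map_smul, map_orbPt]
    exact horb _ _ h.1 h.2
  · rw [fiberHom_cl_eq_zero, map_zero, ← span_of_le hA]
    · rw [not_and_or] at h
      rcases h with h | h
      · rw [idem_mul_span_of_ne (Ne.symm h), zero_mul]
      · rw [mul_assoc, span_mul_idem_of_ne h, mul_zero]
    · intro x hx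
      obtain ⟨g, rfl⟩ := exists_smul_orbPt x
      rw [SetOver.map_smul, map_orbPt] at hx
      exact h ⟨congrArg (fun p : Cosets G × Cosets G => p.1.1) hx,
        congrArg (fun p : Cosets G × Cosets G => p.2.1) hx⟩

omit [Finite G] in
theorem stabilizer_top_left (H : Subgroup G) :
    MulAction.stabilizer G ((pt ⊤ 1, pt H 1) : Cosets G × Cosets G) = H := by
  rw [stabilizer_prod, stabilizer_pt_one, stabilizer_pt_one, top_inf_eq]

omit [Finite G] in
theorem stabilizer_top_right (H : Subgroup G) :
    MulAction.stabilizer G ((pt H 1, pt ⊤ 1) : Cosets G × Cosets G) = H := by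
  rw [stabilizer_prod, stabilizer_pt_one, stabilizer_pt_one, inf_top_eq]

omit [Finite G] in
theorem exists_smul_pt_one {H : Subgroup G} {w : Cosets G} (h : w.1 = H) :
    ∃ g : G, g • pt H 1 = w := by
  subst h
  exact ⟨w.2.out, by rw [smul_pt, mul_one, MackeyAlgebra.exists_pt]⟩

omit [Finite G] in
theorem smul_pt_top {u : Cosets G} (h : u.1 = ⊤) (g : G) : g • pt ⊤ 1 = u := by
  obtain ⟨a, rfl⟩ := exists_smul_pt_one h
  rw [smul_pt, smul_pt, pt_eq_iff]
  trivial

theorem indHom_fiberHom_top_left (H : Subgroup G)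
    (s : BurnsideModule R G (Cosets G × Cosets G)) :
    indHom R (stabilizer_top_left H).ge (fiberHom R (stabilizer_top_left H).ge s) =
      idem R ⊤ * s * idem R H :=
  indHom_fiberHom (stabilizer_top_left H) (fun u w hu hw => by
    obtain ⟨g, rfl⟩ := exists_smul_pt_one hw
    exact ⟨g, Prod.ext (smul_pt_top hu g) rfl⟩) s

theorem indHom_fiberHom_top_right (H : Subgroup G)
    (s : BurnsideModule R G (Cosets G × Cosets G)) :
    indHom R (stabilizer_top_right H).ge (fiberHom R (stabilizer_top_right H).ge s) =
      idem R H * s * idem R ⊤ :=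
  indHom_fiberHom (stabilizer_top_right H) (fun u w hu hw => by
    obtain ⟨g, rfl⟩ := exists_smul_pt_one hu
    exact ⟨g, Prod.ext rfl (smul_pt_top hw g)⟩) s

omit [Finite G] in
theorem le_stabilizer_top (H : Subgroup G) :
    H ≤ MulAction.stabilizer G ((pt ⊤ 1, pt ⊤ 1) : Cosets G × Cosets G) := by
  rw [stabilizer_top_left]
  exact le_top

/-- The pairing of the corners `RB(G/G × G/H)` and `RB(G/H × G/G)` is the product of `RB(H)`,
followed by induction to `G`. -/
theorem indOver_comp_iso {H : Subgroup G} (X Y : FinGSet H) :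
    Iso (indOver (X.prod Y) (le_stabilizer_top H))
      ((indOver X (stabilizer_top_left H).ge).comp (indOver Y (stabilizer_top_right H).ge)) := by
  refine indOver_iso _ _ (fun p => compPt (indPt p.1) (indPt p.2) ?_) ?_ ?_ ?_ ?_ ?_
  · rw [map_indPt, map_indPt]
  · intro p q h
    obtain ⟨h1, h2⟩ := smul_compPt_eq_iff.1 ((one_smul G _).trans h)
    obtain ⟨a, ha, h1⟩ := smul_indPt_eq_iff.1 h1
    obtain ⟨b, hb, h2⟩ := smul_indPt_eq_iff.1 h2
    obtain rfl : a = 1 := Subtype.ext ha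
    obtain rfl : b = 1 := Subtype.ext hb
    exact Prod.ext ((one_smul H p.1).symm.trans h1) ((one_smul H p.2).symm.trans h2)
  · exact fun h p => (smul_compPt_eq_iff.2
      ⟨smul_indPt_eq_iff.2 ⟨h, rfl, rfl⟩, smul_indPt_eq_iff.2 ⟨h, rfl, rfl⟩⟩).symm
  · intro p
    rw [map_compPt, map_indPt, map_indPt]
  · intro p
    obtain ⟨p, q, hpq, rfl⟩ := exists_compPt p
    obtain ⟨a, x, rfl⟩ := exists_smul_indPt p
    obtain ⟨b, y, rfl⟩ := exists_smul_indPt q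
    have hab : a⁻¹ * b ∈ H := by
      rw [SetOver.map_smul, SetOver.map_smul, map_indPt, map_indPt] at hpq
      have h : a • pt H 1 = b • pt H 1 := hpq
      rw [smul_pt, smul_pt, pt_eq_iff] at h
      simpa using h
    refine ⟨a, (x, (⟨a⁻¹ * b, hab⟩ : H) • y), smul_compPt_eq_iff.2 ⟨rfl, ?_⟩⟩
    rw [← smul_indPt_eq_iff.2 ⟨⟨a⁻¹ * b, hab⟩, rfl, rfl⟩, smul_smul, mul_inv_cancel_left]
  · intro g p q h
    obtain ⟨h1, -⟩ := smul_compPt_eq_iff.1 h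
    obtain ⟨a, rfl, -⟩ := smul_indPt_eq_iff.1 h1
    exact a.2

theorem indHom_mul_indHom {H : Subgroup G} (x y : BurnsideAlgebra R H) :
    indHom R (stabilizer_top_left H).ge x * indHom R (stabilizer_top_right H).ge y =
      indHom R (le_stabilizer_top H) (x * y) := by
  suffices h : (LinearMap.mul R (BurnsideModule R G (Cosets G × Cosets G))).compl₁₂
      (indHom R (stabilizer_top_left H).ge) (indHom R (stabilizer_top_right H).ge) =
      (LinearMap.mul R (BurnsideAlgebra R H)).compr₂ (indHom R (le_stabilizer_top H)) from
    LinearMap.congr_fun (LinearMap.congr_fun h x) y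
  refine burnside_hom_ext fun X => burnside_hom_ext fun Y => ?_
  rw [LinearMap.compl₁₂_apply, LinearMap.mul_apply', LinearMap.compr₂_apply, LinearMap.mul_apply',
    burnsideClass_mul, indHom_class, indHom_class, indHom_class, cl_mul_cl]
  exact ((cl_isAdditive R).iso _ _ (indOver_comp_iso X Y)).symm

theorem indOver_ind_iso {H : Subgroup G} (X : FinGSet H) :
    Iso (indOver (X.ind (le_top : H ≤ ⊤)) (le_stabilizer_top ⊤))
      (indOver X (le_stabilizer_top H)) := by
  refine indOver_iso _ _ id Function.injective_id (fun _ _ => rfl) (fun p => ?_)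
    (fun p => ⟨1, p, one_smul _ _⟩) (fun _ _ _ _ => trivial)
  obtain ⟨g, x, rfl⟩ := exists_smul_indPt (hz := le_stabilizer_top H) p
  change (indOver X (le_stabilizer_top H)).map (g • indPt x) = _
  rw [SetOver.map_smul, map_indPt]
  exact Prod.ext (smul_pt_top rfl g) (smul_pt_top rfl g)

end Corner

/-- If the algebra of spans is symmetric, its form restricts to a pairing of the corners
`RB(G/G × G/H)` and `RB(G/H × G/G)`, which is a form on `RB(H)`. -/
theorem stable_of_isSymmAlgebra {R : Type v} [CommRing R] {G : Type u} [Group G] [Finite G]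
    (h : IsSymmAlgebra R (BurnsideModule R G (Cosets G × Cosets G))) :
    BurnsideStableSymmetric R G := by
  obtain ⟨-, -, b, hassoc, hsymm, hb⟩ := h
  have hone (s t) : b (s * t) 1 = b s t := by rw [hassoc, mul_one]
  -- Moving `e` around to the other side uses the symmetry of `b`.
  have hcorner (e s f t) : b (e * s * f) t = b s (f * t * e) := by
    rw [hassoc, hassoc, hsymm, hassoc]
  refine ⟨fun H => b.flip 1 ∘ₗ indHom R (le_stabilizer_top H), fun H X => ?_, fun H => ?_⟩
  · rw [LinearMap.comp_apply, LinearMap.comp_apply, indHom_class, indHom_class]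
    exact congrArg _ ((cl_isAdditive R).iso _ _ (indOver_ind_iso X))
  · set j := indHom R (stabilizer_top_left H).ge with hj
    set j' := indHom R (stabilizer_top_right H).ge with hj'
    set k := fiberHom R (stabilizer_top_left H).ge with hk
    set k' := fiberHom R (stabilizer_top_right H).ge with hk'
    have hform (x y) : mulForm (b.flip 1 ∘ₗ indHom R (le_stabilizer_top H)) x y =
        b (j x) (j' y) := by
      change b (indHom R (le_stabilizer_top H) (x * y)) 1 = _
      rw [← indHom_mul_indHom, hone]
    have hkj (x) : k (j x) = x := fiberHom_indHom R (stabilizer_top_left H) x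
    have hkj' (y) : k' (j' y) = y := fiberHom_indHom R (stabilizer_top_right H) y
    -- `j k` and `j' k'` are the projections to opposite corners, which are adjoint for `b`.
    have hadj (s t) : b (j (k s)) t = b s (j' (k' t)) := by
      rw [hj, hk, hj', hk', indHom_fiberHom_top_left, indHom_fiberHom_top_right, hcorner]
    constructor
    · rw [← LinearMap.ker_eq_bot, LinearMap.ker_eq_bot']
      intro x hx
      have hjx : b (j x) = 0 := by
        refine LinearMap.ext fun t => ?_
        rw [← hkj x, hadj, ← hform, hx]
        rfl
      rw [← hkj x, hb.1 (hjx.trans (map_zero b).symm), map_zero]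
    · intro ψ
      obtain ⟨s, hs⟩ := hb.2 (ψ ∘ₗ k')
      refine ⟨k s, LinearMap.ext fun y => ?_⟩
      rw [hform, hadj, hkj', hs, LinearMap.comp_apply, hkj']

end BurnsideModule

theorem theoremA (G : Type u) [Group G] [Finite G] (R : Type v) [CommRing R] :
    IsSymmAlgebra R (MackeyAlgebra R G) ↔ BurnsideStableSymmetric R G :=
  ⟨fun h => BurnsideModule.stable_of_isSymmAlgebra (h.of_algEquiv (MackeyAlgebra.spanEquiv R G)),
    fun h => (BurnsideModule.isSymmAlgebra_of_stable h).of_algEquiv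
      (MackeyAlgebra.spanEquiv R G).symm⟩
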